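/- Let $\mathcal G$ be a strongly connected digraph on $n\ge 1$ nodes, where every node counts as its own neighbour, and let $B=(b_{ij})\in\mathbb R^{n\times n}$ be column stochastic with $b_{ij}>0$ if $i=j$ or node $i$ receives information from node $j$, and $b_{ij}=0$ otherwise. Let $\pi$ be the right Perron eigenvector of $B$ ($B\pi=\pi$, $\pi>0$, $\sum_i\pi_i=1$), and put $\sigma_B:=\|\mathrm{diag}(\sqrt\pi)^{-1}(B-\pi\mathbf 1^\top)\,\mathrm{diag}(\sqrt\pi)\|_2$, $h:=\max_i\pi_i/\min_i\pi_i$, $\beta:=\sqrt h\,\|\mathbf 1-n\pi\|_2$. With $y_0:=\mathbf 1$, $y_{k+1}:=By_k$ and $Y_k:=\mathrm{diag}(y_k)$, put $y:=\sup_k\|Y_k\|_2$, $y_-:=\sup_k\|Y_k^{-1}\|_2$, and let $\tau:=y_-^6y^2h(1+\beta)$ be the directivity constant. Let $f_1,\dots,f_n:\mathbb R^p\to\mathbb R$ be differentiable, $\mu$-strongly convex and $\ell$-smooth, that is, $\frac\mu2\|x-y\|^2\le f_i(y)-f_i(x)-\nabla f_i(x)^\top(y-x)\le\frac\ell2\|x-y\|^2$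 for all $x,y$, with $\mu,\ell>0$ and $\kappa:=\ell/\mu$, and let $z^*$ be the minimizer of $F=\frac1n\sum_if_i$. From deterministic $x_0^i\in\mathbb R^p$, with $z_0^i=x_0^i$, $y_0^i=1$, $w_0^i=\widehat\nabla f_i(z_0^i)$, S-ADDOPT iterates $$x_{k+1}^i=\sum_jb_{ij}x_k^j-\alpha w_k^i,\quad y_{k+1}^i=\sum_jb_{ij}y_k^j,\quad z_{k+1}^i=x_{k+1}^i/y_{k+1}^i,\quad w_{k+1}^i=\sum_jb_{ij}w_k^j+\widehat\nabla f_i(z_{k+1}^i)-\widehat\nabla f_i(z_k^i),$$ where the stochastic gradient $\widehat\nabla f_i(z_k^i)=g_i(z_k^i,\xi_k^i)$ is drawn once, with random seeds $\xi_k^i$. Let $\mathcal F_k$ be the $\sigma$-algebra generated by the seeds $\xi_l^i$, $l<k$. Assume $\mathbb E[\widehat\nabla f_i(z_k^i)\mid\mathcal F_k]=\nabla f_i(z_k^i)$ and $\mathbb E[\|\widehat\nabla f_i(z_k^i)-\nabla f_i(z_k^i)\|^2\mid\mathcal F_k]\le\sigma^2$, and that the gradient noises of different nodes at the same iteration are conditionally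 uncorrelated given $\mathcal F_k$ (for instance, independent). Then there is an absolute constant $C>0$ such that, for every constant step-size $$0<\alpha\le\frac{1}{\ell\sqrt\kappa}\cdot\frac{(1-\sigma_B^2)^2}{51\sqrt\tau},$$ the mean error $e_k:=\frac1n\,\mathbb E\sum_i\|z_k^i-z^*\|^2$ is finite for all $k$ and converges linearly to a ball: with $$R:=\alpha\cdot C\,\frac{\sigma^2}{n\mu}+\alpha^2\cdot C\,\tau\,\frac{\ell^2\sigma^2}{\mu^2(1-\sigma_B^2)^4},$$ there is $\gamma\in[0,1)$, depending only on $B,\mu,\ell,\alpha$, and a number $M$ (which may depend on the whole problem instance) such that $e_k\le M\gamma^k+R$ for all $k\ge0$; in particular $\limsup_{k\to\infty}e_k\le R$. -/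

import Mathlib

open MeasureTheory Filter
open scoped Matrix

namespace SAddOpt

/-! ### Network -/

/-- Strong connectivity of a digraph: every ordered pair of nodes is joined by a directed path. -/
def IsStronglyConnected {n : ℕ} (G : Digraph (Fin n)) : Prop :=
  ∀ i j, Relation.ReflTransGen G.Adj i j

/-- Column stochastic weights adapted to `G`. `G.Adj i j` means that `i` receives information
from `j`; every node is also a neighbour of itself. -/
structure IsWeightMatrix {n : ℕ} (G : Digraph (Fin n)) (B : Matrix (Fin n) (Fin n) ℝ) :
    Prop where
  nonneg : ∀ i j, 0 ≤ B i j
  pos_iff : ∀ i j, 0 < B i j ↔ (G.Adj i j ∨ i = j)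
  col_sum : ∀ j, ∑ i, B i j = 1

/-- `v` is the normalized right Perron eigenvector of the column stochastic matrix `B`. -/
structure IsPerronVector {n : ℕ} (B : Matrix (Fin n) (Fin n) ℝ) (v : Fin n → ℝ) : Prop where
  pos : ∀ i, 0 < v i
  sum_eq_one : ∑ i, v i = 1
  eigen : B *ᵥ v = v

/-- Spectral norm of a matrix (operator norm for the Euclidean norm). -/
noncomputable def specNorm {n : ℕ} (M : Matrix (Fin n) (Fin n) ℝ) : ℝ :=
  ‖Matrix.toEuclideanCLM (n := Fin n) (𝕜 := ℝ) M‖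

/-- Matrix norm induced by the weighted norm `‖x‖_v = ‖diag(√v)⁻¹ x‖₂`. -/
noncomputable def weightedNorm {n : ℕ} (v : Fin n → ℝ) (M : Matrix (Fin n) (Fin n) ℝ) : ℝ :=
  specNorm ((Matrix.diagonal fun i => √(v i))⁻¹ * M * Matrix.diagonal fun i => √(v i))

/-- `σ_B = ‖B - B^∞‖_π`, where `B^∞ = π 1ᵀ`. -/
noncomputable def sigmaB {n : ℕ} (B : Matrix (Fin n) (Fin n) ℝ) (v : Fin n → ℝ) : ℝ :=
  weightedNorm v (B - Matrix.vecMulVec v 1)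

/-- The eigenvector estimates: `y_0 = 1` and `y_{k+1} = B y_k`. -/
def yVec {n : ℕ} (B : Matrix (Fin n) (Fin n) ℝ) : ℕ → Fin n → ℝ
  | 0 => 1
  | k + 1 => B *ᵥ yVec B k

/-- `y = sup_k ‖Y_k‖₂`, where `Y_k = diag(y_k)`. -/
noncomputable def ySup {n : ℕ} (B : Matrix (Fin n) (Fin n) ℝ) : ℝ :=
  ⨆ k : ℕ, specNorm (Matrix.diagonal (yVec B k))

/-- `y₋ = sup_k ‖Y_k⁻¹‖₂`. -/
noncomputable def yInvSup {n : ℕ} (B : Matrix (Fin n) (Fin n) ℝ) : ℝ :=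
  ⨆ k : ℕ, specNorm (Matrix.diagonal (yVec B k))⁻¹

/-- `h = max π / min π`. -/
noncomputable def hRatio {n : ℕ} (v : Fin n → ℝ) : ℝ :=
  (⨆ i, v i) / (⨅ i, v i)

/-- `β = √h ‖1 - n π‖₂`. -/
noncomputable def beta {n : ℕ} (v : Fin n → ℝ) : ℝ :=
  √(hRatio v) * ‖(WithLp.toLp 2 fun i => 1 - (n : ℝ) * v i : EuclideanSpace ℝ (Fin n))‖

/-- The directivity constant `τ = y₋⁶ y² h (1 + β)`. -/
noncomputable def tau {n : ℕ} (B : Matrix (Fin n) (Fin n) ℝ) (v : Fin n → ℝ) : ℝ :=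
  yInvSup B ^ 6 * ySup B ^ 2 * hRatio v * (1 + beta v)

/-! ### Costs -/

/-- `f` is differentiable, `μ`-strongly convex and `ℓ`-smooth. -/
structure IsStronglyConvexSmooth {p : ℕ} (μ ℓ : ℝ) (f : EuclideanSpace ℝ (Fin p) → ℝ) :
    Prop where
  differentiable : Differentiable ℝ f
  lower : ∀ x y, μ / 2 * ‖x - y‖ ^ 2 ≤ f y - f x - inner ℝ (gradient f x) (y - x)
  upper : ∀ x y, f y - f x - inner ℝ (gradient f x) (y - x) ≤ ℓ / 2 * ‖x - y‖ ^ 2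

/-- The global cost `F = (1/n) ∑ f_i`. -/
noncomputable def globalCost {n p : ℕ} (f : Fin n → EuclideanSpace ℝ (Fin p) → ℝ)
    (z : EuclideanSpace ℝ (Fin p)) : ℝ :=
  (1 / (n : ℝ)) * ∑ i, f i z

/-! ### Algorithm -/

/-- State variables of all the nodes. -/
structure State (n p : ℕ) where
  x : Fin n → EuclideanSpace ℝ (Fin p)
  y : Fin n → ℝ
  z : Fin n → EuclideanSpace ℝ (Fin p)
  w : Fin n → EuclideanSpace ℝ (Fin p)

/-- Iterates of S-ADDOPT along one realization of the oracle: `S k i z` is the stochastic gradient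
that node `i` receives at iteration `k` when it queries the point `z`. -/
noncomputable def iterate {n p : ℕ} (B : Matrix (Fin n) (Fin n) ℝ) (α : ℝ)
    (x₀ : Fin n → EuclideanSpace ℝ (Fin p))
    (S : ℕ → Fin n → EuclideanSpace ℝ (Fin p) → EuclideanSpace ℝ (Fin p)) : ℕ → State n p
  | 0 => { x := x₀, y := fun _ => 1, z := x₀, w := fun i => S 0 i (x₀ i) }
  | k + 1 =>
    let s := iterate B α x₀ S k
    let x' : Fin n → EuclideanSpace ℝ (Fin p) := fun i => ∑ j, B i j • s.x j - α • s.w i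
    let y' : Fin n → ℝ := fun i => ∑ j, B i j * s.y j
    let z' : Fin n → EuclideanSpace ℝ (Fin p) := fun i => (y' i)⁻¹ • x' i
    { x := x'
      y := y'
      z := z'
      w := fun i => ∑ j, B i j • s.w j + S (k + 1) i (z' i) - S k i (s.z i) }

/-- The random estimate `z_k^i` of node `i` at iteration `k`. The stochastic gradients are
`g i z (ξ k i)`, where `ξ k i` is the random seed of node `i` at iteration `k`. -/
noncomputable def zProc {n p : ℕ} {Ω Ξ : Type*} (B : Matrix (Fin n) (Fin n) ℝ) (α : ℝ)
    (x₀ : Fin n → EuclideanSpace ℝ (Fin p))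
    (g : Fin n → EuclideanSpace ℝ (Fin p) → Ξ → EuclideanSpace ℝ (Fin p))
    (ξ : ℕ → Fin n → Ω → Ξ) (k : ℕ) (i : Fin n) (ω : Ω) : EuclideanSpace ℝ (Fin p) :=
  (iterate B α x₀ (fun k i z => g i z (ξ k i ω)) k).z i

/-! ### Oracle -/

/-- The σ-algebra `𝓕_k` generated by the seeds `ξ l i`, `l < k`. -/
@[reducible] def past {n : ℕ} {Ω Ξ : Type*} [MeasurableSpace Ξ] (ξ : ℕ → Fin n → Ω → Ξ) (k : ℕ) :
    MeasurableSpace Ω :=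
  ⨆ l : ℕ, ⨆ _ : l < k, ⨆ i : Fin n, MeasurableSpace.comap (ξ l i) inferInstance

/-- Gradient noise `g i (z_k^i) (ξ k i) - ∇f_i(z_k^i)` along the random points `z k i`. -/
noncomputable def noise {n p : ℕ} {Ω Ξ : Type*} (f : Fin n → EuclideanSpace ℝ (Fin p) → ℝ)
    (g : Fin n → EuclideanSpace ℝ (Fin p) → Ξ → EuclideanSpace ℝ (Fin p))
    (ξ : ℕ → Fin n → Ω → Ξ) (z : ℕ → Fin n → Ω → EuclideanSpace ℝ (Fin p))
    (k : ℕ) (i : Fin n) (ω : Ω) : EuclideanSpace ℝ (Fin p) :=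
  g i (z k i ω) (ξ k i ω) - gradient (f i) (z k i ω)

/-- Stochastic first-order oracle: given the past, the stochastic gradients at the current points
`z k i` are unbiased, have variance at most `σ²`, and have noises that are uncorrelated between
different nodes. -/
structure IsSFO {n p : ℕ} {Ω Ξ : Type*} [MeasurableSpace Ω] [MeasurableSpace Ξ]
    (P : Measure Ω) (f : Fin n → EuclideanSpace ℝ (Fin p) → ℝ) (σ : ℝ)
    (g : Fin n → EuclideanSpace ℝ (Fin p) → Ξ → EuclideanSpace ℝ (Fin p))
    (ξ : ℕ → Fin n → Ω → Ξ) (z : ℕ → Fin n → Ω → EuclideanSpace ℝ (Fin p)) : Prop where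
  measurable_seed : ∀ k i, Measurable (ξ k i)
  measurable_grad : ∀ i, Measurable (Function.uncurry (g i))
  integrable_sq : ∀ k i, Integrable (fun ω => ‖noise f g ξ z k i ω‖ ^ 2) P
  unbiased : ∀ k i, P[fun ω => g i (z k i ω) (ξ k i ω) | past ξ k]
    =ᵐ[P] fun ω => gradient (f i) (z k i ω)
  variance_le : ∀ k i, P[fun ω => ‖noise f g ξ z k i ω‖ ^ 2 | past ξ k] ≤ᵐ[P] fun _ => σ ^ 2
  uncorrelated : ∀ k i j, i ≠ j →
    P[fun ω => inner ℝ (noise f g ξ z k i ω) (noise f g ξ z k j ω) | past ξ k] =ᵐ[P] 0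

/-- Squared distance `‖z_k - 1 ⊗ z*‖₂²` of the network to `z*`. -/
noncomputable def sqDist {n p : ℕ} {Ω : Type*} (z : ℕ → Fin n → Ω → EuclideanSpace ℝ (Fin p))
    (zstar : EuclideanSpace ℝ (Fin p)) (k : ℕ) (ω : Ω) : ℝ :=
  ∑ i, ‖z k i ω - zstar‖ ^ 2

/-- The mean error `e_k = (1/n) E ‖z_k - 1 ⊗ z*‖₂²`. -/
noncomputable def meanError {n p : ℕ} {Ω : Type*} [MeasurableSpace Ω] (P : Measure Ω)
    (z : ℕ → Fin n → Ω → EuclideanSpace ℝ (Fin p)) (zstar : EuclideanSpace ℝ (Fin p))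
    (k : ℕ) : ℝ :=
  (1 / (n : ℝ)) * ∫ ω, sqDist z zstar k ω ∂P

/-- Size of the asymptotic error ball, with the constant `C` in the order-`α` term and `C τ` in the
order-`α²` term. -/
noncomputable def residual {n : ℕ} (C : ℝ) (B : Matrix (Fin n) (Fin n) ℝ) (v : Fin n → ℝ)
    (μ ℓ σ α : ℝ) : ℝ :=
  α * (C * (σ ^ 2 / (n * μ))) +
    α ^ 2 * (C * tau B v * (ℓ ^ 2 * σ ^ 2 / (μ ^ 2 * (1 - sigmaB B v ^ 2) ^ 4)))

end SAddOpt

/-!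
# Linear convergence of S-ADDOPT to a ball

Subtracting from a family `u` of node states its average spread along weights `y` of total mass `n`
leaves the zero-sum family `dev y u`. Since `B` sends `y_k` to `y_{k+1}` and preserves averages, the
deviations of `x_k` along `y_k` and of `w_k` along `y_{k+1}` satisfy recursions *without* the
perturbation terms that appear when the averages are spread along the limit `n π`
(`dev_iterate_x_succ`, `dev_iterate_w_succ`):

`x̂_{k+1} = B x̂_k - α ŵ_k`,  `ŵ_{k+1} = B ŵ_k + dev y_{k+2} (ĝ_{k+1} - ĝ_k)`,

where `ĝ_k` are the sampled gradients, and `z_k = x̄_k + Y_k⁻¹ x̂_k`, `x̄_{k+1} = x̄_k - α avg ĝ_k`.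
On zero-sum families `B` contracts the `π`-weighted norm by `σ_B < 1`. This is Jensen's inequality,
whose defect is a sum of variances that vanishes only for multiples of `π`
(`sum_sq_div_sub_mulVec`, `sigmaB_lt_one`).

Three errors are followed: the consensus error of `x̂`, the tracking error of `ŵ`, and the
optimality error `n ‖x̄ - z*‖²`. The first two obey pathwise inequalities in which the gradient noise
enters only through its square (`consensusErr_succ_le`, `trackingErr_succ_le_of_costs`). The third
is an inexact gradient step for the global cost; in expectation its noise is orthogonal to the past,
and its variance is divided by `n` as the nodes are uncorrelated (`integral_optErr_succ_le`).

The expected errors thus satisfy a nonnegative linear system of three inequalities. The step-size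
bound makes its loop gains small: with `λ = 1 - σ_B²` and `H = y₋² y² h ≤ τ`, it gives
`α² ℓ³ H / (μ λ⁴) ≤ 51⁻²`. An explicit positive vector then decays under the system by
`1 - α μ / 4` per step, and an explicit supersolution absorbs the noise; comparison with both gives
the bound `M γ^k + R` (`exists_le_geometric_add`, `consensus_add_opt_le`, `meanError_le`). The
comparison is componentwise, so that the noise contributions keep their separate scales in `R`.

If `ℓ < μ`, the space is a point and there is nothing to prove.
-/

namespace SAddOpt

variable {n : ℕ}

/-! ### Spectral norms and the eigenvector estimates -/

lemma specNorm_diagonal (u : Fin n → ℝ) : specNorm (Matrix.diagonal u) = ‖u‖ := by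
  open scoped Matrix.Norms.L2Operator in
  exact Matrix.l2_opNorm_diagonal u

section Network

variable {G : Digraph (Fin n)} {B : Matrix (Fin n) (Fin n) ℝ} {v : Fin n → ℝ}

lemma yVec_succ_apply (B : Matrix (Fin n) (Fin n) ℝ) (k : ℕ) (i : Fin n) :
    yVec B (k + 1) i = ∑ j, B i j * yVec B k j := rfl

lemma IsPerronVector.sum_mul (hv : IsPerronVector B v) (i : Fin n) : ∑ j, B i j * v j = v i :=
  congrFun hv.eigen i

lemma IsPerronVector.le_one (hv : IsPerronVector B v) (i : Fin n) : v i ≤ 1 := by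
  rw [← hv.sum_eq_one]
  exact Finset.single_le_sum (fun j _ => (hv.pos j).le) (Finset.mem_univ i)

/-- The eigenvector estimates stay above the Perron vector, hence away from zero. -/
lemma perron_le_yVec (hB : IsWeightMatrix G B) (hv : IsPerronVector B v) (k : ℕ) :
    ∀ i, v i ≤ yVec B k i := by
  induction k with
  | zero => exact hv.le_one
  | succ k ih =>
    intro i
    rw [yVec_succ_apply, ← hv.sum_mul i]
    exact Finset.sum_le_sum fun j _ => mul_le_mul_of_nonneg_left (ih j) (hB.nonneg i j)

lemma yVec_pos (hB : IsWeightMatrix G B) (hv : IsPerronVector B v) (k : ℕ) (i : Fin n) :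
    0 < yVec B k i :=
  (hv.pos i).trans_le (perron_le_yVec hB hv k i)

lemma sum_yVec (hB : IsWeightMatrix G B) (k : ℕ) : ∑ i, yVec B k i = n := by
  induction k with
  | zero => simp [yVec]
  | succ k ih =>
    simp_rw [yVec_succ_apply]
    rw [Finset.sum_comm]
    simp_rw [← Finset.sum_mul, hB.col_sum, one_mul]
    exact ih

lemma bddAbove_specNorm_yVec (hB : IsWeightMatrix G B) (hv : IsPerronVector B v) :
    BddAbove (Set.range fun k => specNorm (Matrix.diagonal (yVec B k))) := by
  refine ⟨n, ?_⟩
  rintro _ ⟨k, rfl⟩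
  simp only
  rw [specNorm_diagonal, pi_norm_le_iff_of_nonneg (by positivity)]
  intro i
  rw [Real.norm_of_nonneg (yVec_pos hB hv k i).le, ← sum_yVec hB k]
  exact Finset.single_le_sum (fun j _ => (yVec_pos hB hv k j).le) (Finset.mem_univ i)

lemma inv_diagonal_yVec (hB : IsWeightMatrix G B) (hv : IsPerronVector B v) (k : ℕ) :
    (Matrix.diagonal (yVec B k))⁻¹ = Matrix.diagonal fun i => (yVec B k i)⁻¹ := by
  apply Matrix.inv_eq_right_inv
  rw [Matrix.diagonal_mul_diagonal, ← Matrix.diagonal_one]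
  congr 1
  funext i
  exact mul_inv_cancel₀ (yVec_pos hB hv k i).ne'

lemma bddAbove_specNorm_inv_yVec (hB : IsWeightMatrix G B) (hv : IsPerronVector B v) :
    BddAbove (Set.range fun k => specNorm (Matrix.diagonal (yVec B k))⁻¹) := by
  refine ⟨∑ j, (v j)⁻¹, ?_⟩
  rintro _ ⟨k, rfl⟩
  have h0 : ∀ j, 0 ≤ (v j)⁻¹ := fun j => (inv_pos.2 (hv.pos j)).le
  simp only
  rw [inv_diagonal_yVec hB hv, specNorm_diagonal,
    pi_norm_le_iff_of_nonneg (Finset.sum_nonneg fun j _ => h0 j)]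
  intro i
  rw [Real.norm_of_nonneg (inv_pos.2 (yVec_pos hB hv k i)).le]
  exact (inv_anti₀ (hv.pos i) (perron_le_yVec hB hv k i)).trans
    (Finset.single_le_sum (fun j _ => h0 j) (Finset.mem_univ i))

lemma yVec_le_ySup (hB : IsWeightMatrix G B) (hv : IsPerronVector B v) (k : ℕ) (i : Fin n) :
    yVec B k i ≤ ySup B :=
  calc yVec B k i ≤ ‖yVec B k i‖ := Real.le_norm_self _
    _ ≤ ‖yVec B k‖ := norm_le_pi_norm _ i
    _ = specNorm (Matrix.diagonal (yVec B k)) := (specNorm_diagonal _).symm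
    _ ≤ ySup B := le_ciSup (bddAbove_specNorm_yVec hB hv) k

lemma inv_yVec_le_yInvSup (hB : IsWeightMatrix G B) (hv : IsPerronVector B v) (k : ℕ)
    (i : Fin n) : (yVec B k i)⁻¹ ≤ yInvSup B :=
  calc (yVec B k i)⁻¹ ≤ ‖(yVec B k i)⁻¹‖ := Real.le_norm_self _
    _ ≤ ‖fun i => (yVec B k i)⁻¹‖ := norm_le_pi_norm (fun i => (yVec B k i)⁻¹) i
    _ = specNorm (Matrix.diagonal (yVec B k))⁻¹ := by
      rw [inv_diagonal_yVec hB hv, specNorm_diagonal]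
    _ ≤ yInvSup B := le_ciSup (bddAbove_specNorm_inv_yVec hB hv) k

lemma one_le_ySup (hn : 0 < n) (hB : IsWeightMatrix G B) (hv : IsPerronVector B v) :
    1 ≤ ySup B := yVec_le_ySup hB hv 0 ⟨0, hn⟩

lemma one_le_yInvSup (hn : 0 < n) (hB : IsWeightMatrix G B) (hv : IsPerronVector B v) :
    1 ≤ yInvSup B := by
  simpa [yVec] using inv_yVec_le_yInvSup hB hv 0 ⟨0, hn⟩

lemma iSup_perron_pos (hn : 0 < n) (hv : IsPerronVector B v) : 0 < ⨆ i, v i :=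
  (hv.pos ⟨0, hn⟩).trans_le (le_ciSup (Finite.bddAbove_range v) _)

lemma iInf_perron_pos (hn : 0 < n) (hv : IsPerronVector B v) : 0 < ⨅ i, v i := by
  have : Nonempty (Fin n) := ⟨⟨0, hn⟩⟩
  obtain ⟨i, hi⟩ := exists_eq_ciInf_of_finite (f := v)
  exact hi ▸ hv.pos i

lemma one_le_hRatio (hn : 0 < n) (hv : IsPerronVector B v) : 1 ≤ hRatio v := by
  rw [hRatio, one_le_div (iInf_perron_pos hn hv)]
  exact (ciInf_le (Finite.bddBelow_range v) ⟨0, hn⟩).trans (le_ciSup (Finite.bddAbove_range v) _)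

lemma one_le_yInvSup_mul_ySup_mul_hRatio (hn : 0 < n) (hB : IsWeightMatrix G B)
    (hv : IsPerronVector B v) : 1 ≤ yInvSup B ^ 2 * ySup B ^ 2 * hRatio v :=
  one_le_mul_of_one_le_of_one_le (one_le_mul_of_one_le_of_one_le
    (one_le_pow₀ (one_le_yInvSup hn hB hv)) (one_le_pow₀ (one_le_ySup hn hB hv)))
    (one_le_hRatio hn hv)

/-- The part of the directivity constant that governs the convergence is `y₋² y² h`. -/
lemma le_tau (hn : 0 < n) (hB : IsWeightMatrix G B) (hv : IsPerronVector B v) :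
    yInvSup B ^ 2 * ySup B ^ 2 * hRatio v ≤ tau B v := by
  have h1 := one_le_yInvSup hn hB hv
  have h2 := one_le_hRatio hn hv
  have h3 : 0 ≤ beta v := by unfold beta; positivity
  have h4 : yInvSup B ^ 2 ≤ yInvSup B ^ 6 := pow_le_pow_right₀ h1 (by norm_num)
  calc yInvSup B ^ 2 * ySup B ^ 2 * hRatio v
      ≤ yInvSup B ^ 6 * ySup B ^ 2 * hRatio v := by gcongr
    _ ≤ tau B v := le_mul_of_one_le_right (by positivity) (by linarith)

/-! ### Contraction of the mixing step in the weighted norm -/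

/-- Jensen's inequality for the mixing step, with its defect written as a sum of variances. -/
lemma sum_sq_div_sub_mulVec (hB : IsWeightMatrix G B) (hv : IsPerronVector B v)
    (u : Fin n → ℝ) :
    ∑ i, u i ^ 2 / v i - ∑ i, (B *ᵥ u) i ^ 2 / v i =
      ∑ i, ∑ j, B i j * v j * (u j / v j - (B *ᵥ u) i / v i) ^ 2 := by
  have key : ∀ i, ∑ j, B i j * v j * (u j / v j - (B *ᵥ u) i / v i) ^ 2 =
      ∑ j, B i j * (u j ^ 2 / v j) - (B *ᵥ u) i ^ 2 / v i := by
    intro i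
    have h1 : ∀ j, B i j * v j * (u j / v j - (B *ᵥ u) i / v i) ^ 2 =
        B i j * (u j ^ 2 / v j) - 2 * ((B *ᵥ u) i / v i) * (B i j * u j) +
          ((B *ᵥ u) i / v i) ^ 2 * (B i j * v j) := by
      intro j
      have := (hv.pos j).ne'
      have := (hv.pos i).ne'
      field_simp
      ring
    have h2 : ∑ j, B i j * u j = (B *ᵥ u) i := rfl
    simp_rw [h1, Finset.sum_add_distrib, Finset.sum_sub_distrib, ← Finset.mul_sum]
    rw [h2, hv.sum_mul i]
    have := (hv.pos i).ne'
    field_simp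
    ring
  simp_rw [key, Finset.sum_sub_distrib]
  rw [Finset.sum_comm]
  simp_rw [← Finset.sum_mul, hB.col_sum, one_mul]

lemma sum_sq_div_mulVec_lt (hG : IsStronglyConnected G) (hB : IsWeightMatrix G B)
    (hv : IsPerronVector B v) {u : Fin n → ℝ} (hu : ∑ i, u i = 0) (hu0 : u ≠ 0) :
    ∑ i, (B *ᵥ u) i ^ 2 / v i < ∑ i, u i ^ 2 / v i := by
  have hid := sum_sq_div_sub_mulVec hB hv u
  have hterm : ∀ i j, 0 ≤ B i j * v j * (u j / v j - (B *ᵥ u) i / v i) ^ 2 := fun i j =>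
    mul_nonneg (mul_nonneg (hB.nonneg i j) (hv.pos j).le) (sq_nonneg _)
  have hsum : ∀ i, 0 ≤ ∑ j, B i j * v j * (u j / v j - (B *ᵥ u) i / v i) ^ 2 :=
    fun i => Finset.sum_nonneg fun j _ => hterm i j
  by_contra! hle
  have hzero : ∑ i, ∑ j, B i j * v j * (u j / v j - (B *ᵥ u) i / v i) ^ 2 = 0 :=
    le_antisymm (by linarith) (Finset.sum_nonneg fun i _ => hsum i)
  -- A vanishing defect forces `u / v` to be constant along edges, hence everywhere.
  have hloc : ∀ i j, 0 < B i j → u j / v j = (B *ᵥ u) i / v i := by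
    intro i j hij
    have h1 := (Finset.sum_eq_zero_iff_of_nonneg fun i _ => hsum i).1 hzero i (Finset.mem_univ i)
    have h2 := (Finset.sum_eq_zero_iff_of_nonneg fun j _ => hterm i j).1 h1 j (Finset.mem_univ j)
    have h3 := (mul_eq_zero.1 h2).resolve_left (mul_pos hij (hv.pos j)).ne'
    exact sub_eq_zero.1 (pow_eq_zero_iff two_ne_zero |>.1 h3)
  have hadj : ∀ i j, G.Adj i j → u i / v i = u j / v j := fun i j h =>
    (hloc i i ((hB.pos_iff i i).2 (Or.inr rfl))).trans
      (hloc i j ((hB.pos_iff i j).2 (Or.inl h))).symm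
  have hconst : ∀ i j, u i / v i = u j / v j := by
    intro i j
    induction hG i j with
    | refl => rfl
    | tail _ h ih => exact ih.trans (hadj _ _ h)
  apply hu0
  funext i
  have h1 : ∀ j, u j = u i / v i * v j := fun j => by
    rw [hconst i j, div_mul_cancel₀ _ (hv.pos j).ne']
  rw [Finset.sum_congr rfl fun j _ => h1 j, ← Finset.mul_sum, hv.sum_eq_one, mul_one] at hu
  rw [h1 i, hu, zero_mul, Pi.zero_apply]

/-- Action of the matrix whose spectral norm is `σ_B`. -/
lemma weighted_mulVec (hv : IsPerronVector B v) (u : Fin n → ℝ) :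
    ((Matrix.diagonal fun i => √(v i))⁻¹ * (B - Matrix.vecMulVec v 1) *
        Matrix.diagonal fun i => √(v i)) *ᵥ u =
      fun i => ((B *ᵥ fun j => √(v j) * u j) i - v i * ∑ j, √(v j) * u j) / √(v i) := by
  have hinv : (Matrix.diagonal fun i => √(v i))⁻¹ = Matrix.diagonal fun i => (√(v i))⁻¹ := by
    apply Matrix.inv_eq_right_inv
    rw [Matrix.diagonal_mul_diagonal, ← Matrix.diagonal_one]
    congr 1
    funext i
    exact mul_inv_cancel₀ (Real.sqrt_pos.2 (hv.pos i)).ne'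
  have hd : (Matrix.diagonal fun i => √(v i)) *ᵥ u = fun j => √(v j) * u j := by
    funext j
    rw [Matrix.mulVec_diagonal]
  rw [hinv, ← Matrix.mulVec_mulVec, ← Matrix.mulVec_mulVec, hd]
  funext i
  rw [Matrix.mulVec_diagonal, Matrix.sub_mulVec, Pi.sub_apply, Matrix.vecMulVec_mulVec,
    div_eq_inv_mul]
  simp [dotProduct, mul_comm]

lemma norm_sq_weighted (hv : IsPerronVector B v) (u : EuclideanSpace ℝ (Fin n)) :
    ‖Matrix.toEuclideanCLM (n := Fin n) (𝕜 := ℝ) ((Matrix.diagonal fun i => √(v i))⁻¹ *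
        (B - Matrix.vecMulVec v 1) * Matrix.diagonal fun i => √(v i)) u‖ ^ 2 =
      ∑ i, ((B *ᵥ fun j => √(v j) * u j) i - v i * ∑ j, √(v j) * u j) ^ 2 / v i := by
  obtain ⟨u, rfl⟩ : ∃ w, u = WithLp.toLp 2 w := ⟨u.ofLp, rfl⟩
  rw [Matrix.toEuclideanCLM_toLp, weighted_mulVec hv, EuclideanSpace.real_norm_sq_eq]
  simp [div_pow, Real.sq_sqrt (hv.pos _).le]

lemma sigmaB_nonneg : 0 ≤ sigmaB B v := norm_nonneg _

lemma one_sub_sigmaB_sq_pos (hσ : sigmaB B v < 1) : 0 < 1 - sigmaB B v ^ 2 :=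
  sub_pos.2 (pow_lt_one₀ sigmaB_nonneg hσ two_ne_zero)

/-- The mixing step contracts the zero-sum vectors strictly; compactness of the sphere turns this
into a spectral norm below one. -/
lemma sigmaB_lt_one (hn : 0 < n) (hG : IsStronglyConnected G) (hB : IsWeightMatrix G B)
    (hv : IsPerronVector B v) : sigmaB B v < 1 := by
  set A := Matrix.toEuclideanCLM (n := Fin n) (𝕜 := ℝ) ((Matrix.diagonal fun i => √(v i))⁻¹ *
        (B - Matrix.vecMulVec v 1) * Matrix.diagonal fun i => √(v i)) with hA
  have hlt : ∀ u : EuclideanSpace ℝ (Fin n), u ≠ 0 → ‖A u‖ < ‖u‖ := by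
    intro u hu
    refine lt_of_pow_lt_pow_left₀ 2 (norm_nonneg u) ?_
    rw [norm_sq_weighted hv]
    set s := ∑ j, √(v j) * u j with hs
    set x : Fin n → ℝ := fun j => √(v j) * u j - s * v j with hx
    have hBx : ∀ i, (B *ᵥ fun j => √(v j) * u j) i - v i * s = (B *ᵥ x) i := by
      intro i
      have hxe : x = (fun j => √(v j) * u j) - s • v := by
        funext j; simp [hx]
      rw [hxe, Matrix.mulVec_sub, Matrix.mulVec_smul, hv.eigen]
      simp [mul_comm]
    simp_rw [hBx]
    have hx0 : ∑ j, x j = 0 := by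
      simp only [hx, Finset.sum_sub_distrib, ← Finset.mul_sum, hv.sum_eq_one, ← hs]
      ring
    have hnorm : ∑ i, x i ^ 2 / v i = ‖u‖ ^ 2 - s ^ 2 := by
      have h1 : ∀ i, x i ^ 2 / v i = u i ^ 2 - 2 * s * (√(v i) * u i) + s ^ 2 * v i := by
        intro i
        have h2 := (hv.pos i).ne'
        have h3 := Real.sq_sqrt (hv.pos i).le
        rw [div_eq_iff h2]
        simp only [hx]
        linear_combination (u i ^ 2) * h3
      simp_rw [h1, Finset.sum_add_distrib, Finset.sum_sub_distrib, ← Finset.mul_sum]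
      rw [hv.sum_eq_one, ← hs, EuclideanSpace.real_norm_sq_eq]
      ring
    by_cases hxz : x = 0
    · rw [hxz]
      simp only [Matrix.mulVec_zero, Pi.zero_apply]
      simpa using pow_pos (norm_pos_iff.2 hu) 2
    · have := sum_sq_div_mulVec_lt hG hB hv hx0 hxz
      nlinarith [sq_nonneg s]
  have : Nontrivial (EuclideanSpace ℝ (Fin n)) := by
    have : Nonempty (Fin n) := ⟨⟨0, hn⟩⟩
    infer_instance
  obtain ⟨u₀, hu₀, hmax⟩ := (isCompact_sphere (0 : EuclideanSpace ℝ (Fin n)) 1).exists_isMaxOn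
    (NormedSpace.sphere_nonempty.2 zero_le_one) (A.continuous.norm.continuousOn)
  have hu₀' : ‖u₀‖ = 1 := by simpa using hu₀
  have h1 : ‖A u₀‖ < 1 := hu₀' ▸ hlt u₀ (by rintro rfl; simp at hu₀')
  refine lt_of_le_of_lt ?_ h1
  refine ContinuousLinearMap.opNorm_le_of_unit_norm (norm_nonneg _) fun u hu => ?_
  exact hmax (by simpa using hu)

lemma sum_sq_div_mulVec_le (hv : IsPerronVector B v) {u : Fin n → ℝ} (hu : ∑ i, u i = 0) :
    ∑ i, (B *ᵥ u) i ^ 2 / v i ≤ sigmaB B v ^ 2 * ∑ i, u i ^ 2 / v i := by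
  have hs : ∀ i, √(v i) ≠ 0 := fun i => (Real.sqrt_pos.2 (hv.pos i)).ne'
  have h1 := norm_sq_weighted hv (WithLp.toLp 2 fun i => u i / √(v i))
  have h2 : (fun j => √(v j) * (u j / √(v j))) = u := by
    funext j
    exact mul_div_cancel₀ _ (hs j)
  have h3 : ∀ j, √(v j) * (u j / √(v j)) = u j := congrFun h2
  simp only [h3, hu, mul_zero, sub_zero] at h1
  rw [← h1]
  have h4 : ∑ i, u i ^ 2 / v i = ‖(WithLp.toLp 2 fun i => u i / √(v i) :
      EuclideanSpace ℝ (Fin n))‖ ^ 2 := by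
    rw [EuclideanSpace.real_norm_sq_eq]
    simp [div_pow, Real.sq_sqrt (hv.pos _).le]
  rw [h4, ← mul_pow]
  gcongr
  exact ContinuousLinearMap.le_opNorm _ _

/-- Squared weighted norm of a family of vectors, one per node: `∑ ‖u i‖² / v i`. -/
noncomputable def weightedSq {E : Type*} [NormedAddCommGroup E] (v : Fin n → ℝ)
    (u : Fin n → E) : ℝ :=
  ∑ i, ‖u i‖ ^ 2 / v i

/-- The contraction of the mixing step by `σ_B`, for vector-valued states. -/
lemma weightedSq_mix_le {p : ℕ} (hv : IsPerronVector B v)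
    {u : Fin n → EuclideanSpace ℝ (Fin p)} (hu : ∑ i, u i = 0) :
    weightedSq v (fun i => ∑ j, B i j • u j) ≤ sigmaB B v ^ 2 * weightedSq v u := by
  have h : ∀ w : Fin n → EuclideanSpace ℝ (Fin p),
      weightedSq v w = ∑ c, ∑ i, w i c ^ 2 / v i := by
    intro w
    simp_rw [weightedSq, EuclideanSpace.real_norm_sq_eq, Finset.sum_div]
    exact Finset.sum_comm
  rw [h, h, Finset.mul_sum]
  refine Finset.sum_le_sum fun c _ => ?_
  have hc : ∑ i, u i c = 0 := by
    simpa using congrArg (fun w : EuclideanSpace ℝ (Fin p) => w c) hu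
  have hmix : ∀ i, (∑ j, B i j • u j) c = (B *ᵥ fun j => u j c) i := by
    intro i
    simp [Matrix.mulVec, dotProduct]
  simp_rw [hmix]
  exact sum_sq_div_mulVec_le hv hc

end Network

/-! ### Strongly convex and smooth costs -/

section Costs

variable {E : Type*} [NormedAddCommGroup E] [InnerProductSpace ℝ E]

/-- `F` lies between two quadratics tangent to its graph, where `D x` plays the role of the
gradient at `x`. The facts below need no differentiability beyond these bounds. -/
structure HasQuadraticBounds (μ ℓ : ℝ) (F : E → ℝ) (D : E → E) : Prop where
  lower : ∀ x y, μ / 2 * ‖x - y‖ ^ 2 ≤ F y - F x - inner ℝ (D x) (y - x)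
  upper : ∀ x y, F y - F x - inner ℝ (D x) (y - x) ≤ ℓ / 2 * ‖x - y‖ ^ 2

variable {μ ℓ : ℝ} {F : E → ℝ} {D : E → E}

lemma IsStronglyConvexSmooth.hasQuadraticBounds {p : ℕ} {f : EuclideanSpace ℝ (Fin p) → ℝ}
    (hf : IsStronglyConvexSmooth μ ℓ f) : HasQuadraticBounds μ ℓ f (gradient f) :=
  ⟨hf.lower, hf.upper⟩

lemma HasQuadraticBounds.descent (h : HasQuadraticBounds μ ℓ F D) (hℓ : 0 < ℓ) (x d : E) :
    F (x - ℓ⁻¹ • d) ≤ F x - ℓ⁻¹ * inner ℝ (D x) d + ℓ⁻¹ / 2 * ‖d‖ ^ 2 := by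
  have h1 := h.upper x (x - ℓ⁻¹ • d)
  rw [sub_sub_cancel, sub_sub_cancel_left, inner_neg_right, inner_smul_right, norm_smul, mul_pow,
    Real.norm_of_nonneg (inv_pos.2 hℓ).le] at h1
  have h2 : ℓ / 2 * (ℓ⁻¹ ^ 2 * ‖d‖ ^ 2) = ℓ⁻¹ / 2 * ‖d‖ ^ 2 := by
    field_simp
  linarith

/-- One half of the co-coercivity of the gradient. -/
lemma HasQuadraticBounds.cocoercive_half (h : HasQuadraticBounds μ ℓ F D) (hμ : 0 ≤ μ)
    (hℓ : 0 < ℓ) (x y : E) :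
    F x + inner ℝ (D x) (y - x) + ℓ⁻¹ / 2 * ‖D y - D x‖ ^ 2 ≤ F y := by
  have h1 := h.descent hℓ y (D y - D x)
  have h2 := h.lower x (y - ℓ⁻¹ • (D y - D x))
  have h3 : 0 ≤ μ / 2 * ‖x - (y - ℓ⁻¹ • (D y - D x))‖ ^ 2 := by positivity
  have h4 : inner ℝ (D x) (y - ℓ⁻¹ • (D y - D x) - x) =
      inner ℝ (D x) (y - x) - ℓ⁻¹ * inner ℝ (D x) (D y - D x) := by
    rw [sub_right_comm, inner_sub_right, inner_smul_right]
  have h5 : inner ℝ (D y) (D y - D x) - inner ℝ (D x) (D y - D x) = ‖D y - D x‖ ^ 2 := by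
    rw [← inner_sub_left, real_inner_self_eq_norm_sq]
  rw [h4] at h2
  linear_combination h1 + h2 + h3 - ℓ⁻¹ * h5

lemma HasQuadraticBounds.norm_sub_le (h : HasQuadraticBounds μ ℓ F D) (hμ : 0 ≤ μ)
    (hℓ : 0 < ℓ) (x y : E) : ‖D x - D y‖ ≤ ℓ * ‖x - y‖ := by
  have h1 := h.cocoercive_half hμ hℓ x y
  have h2 := h.cocoercive_half hμ hℓ y x
  have h3 : inner ℝ (D x) (y - x) = - inner ℝ (D x) (x - y) := by
    rw [← inner_neg_right, neg_sub]
  rw [norm_sub_rev (D y)] at h1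
  have h4 : inner ℝ (D x) (x - y) - inner ℝ (D y) (x - y) ≤ ‖D x - D y‖ * ‖x - y‖ := by
    rw [← inner_sub_left]
    exact real_inner_le_norm _ _
  have h5 : ℓ⁻¹ * ‖D x - D y‖ ^ 2 ≤ ‖D x - D y‖ * ‖x - y‖ := by linarith
  rcases (norm_nonneg (D x - D y)).eq_or_lt with h6 | h6
  · rw [← h6]; positivity
  · have h7 : ‖D x - D y‖ * (ℓ⁻¹ * ‖D x - D y‖) ≤ ‖D x - D y‖ * ‖x - y‖ := by
      linarith [show ‖D x - D y‖ * (ℓ⁻¹ * ‖D x - D y‖) = ℓ⁻¹ * ‖D x - D y‖ ^ 2 by ring]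
    have h8 := le_of_mul_le_mul_left h7 h6
    rwa [inv_mul_le_iff₀ hℓ] at h8

/-- The gradient is controlled by the distance to the minimal value. -/
lemma HasQuadraticBounds.norm_sq_le (h : HasQuadraticBounds μ ℓ F D) (hℓ : 0 < ℓ) {zs : E}
    (hz : ∀ z, F zs ≤ F z) (x : E) : ‖D x‖ ^ 2 ≤ 2 * ℓ * (F x - F zs) := by
  have h1 := (hz _).trans (h.descent hℓ x (D x))
  rw [real_inner_self_eq_norm_sq] at h1
  have h2 : ℓ⁻¹ / 2 * ‖D x‖ ^ 2 ≤ F x - F zs := by linarith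
  have h3 := mul_le_mul_of_nonneg_left h2 (by positivity : 0 ≤ 2 * ℓ)
  have h4 : 2 * ℓ * (ℓ⁻¹ / 2 * ‖D x‖ ^ 2) = ‖D x‖ ^ 2 := by field_simp
  linarith

lemma HasQuadraticBounds.eq_zero (h : HasQuadraticBounds μ ℓ F D) (hℓ : 0 < ℓ) {zs : E}
    (hz : ∀ z, F zs ≤ F z) : D zs = 0 := by
  have := h.norm_sq_le hℓ hz zs
  rw [sub_self, mul_zero] at this
  simpa using le_antisymm this (by positivity)

/-- A gradient step with an inexact gradient `d` contracts towards the minimizer, up to the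
gradient error. -/
lemma HasQuadraticBounds.inexact_step (h : HasQuadraticBounds μ ℓ F D) (hμ : 0 < μ) (hℓ : 0 < ℓ)
    {zs : E} (hz : ∀ z, F zs ≤ F z) {α : ℝ} (hα : 0 < α) (hαμ : α * μ ≤ 1) (hαℓ : α * ℓ ≤ 1)
    (x d : E) :
    ‖x - α • d - zs‖ ^ 2 ≤
      (1 - α * μ / 2) * ‖x - zs‖ ^ 2 + 3 * α / μ * ‖d - D x‖ ^ 2 := by
  have h1 := h.norm_sq_le hℓ hz x
  have h2 := h.lower x zs
  have h3 : inner ℝ (D x) (zs - x) = - inner ℝ (x - zs) (D x) := by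
    rw [real_inner_comm, ← inner_neg_left, neg_sub]
  have hF : 0 ≤ F x - F zs := sub_nonneg.2 (hz x)
  -- The exact gradient step contracts by `1 - α μ`.
  have h4 : ‖x - zs - α • D x‖ ^ 2 ≤ (1 - α * μ) * ‖x - zs‖ ^ 2 := by
    rw [norm_sub_sq_real, inner_smul_right, norm_smul, Real.norm_of_nonneg hα.le, mul_pow]
    have h5 : α ^ 2 * ‖D x‖ ^ 2 ≤ α ^ 2 * (2 * ℓ * (F x - F zs)) := by gcongr
    have h6 : α ^ 2 * (2 * ℓ * (F x - F zs)) ≤ 2 * α * (F x - F zs) := by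
      have : 2 * α * (F x - F zs) * (α * ℓ) ≤ 2 * α * (F x - F zs) * 1 := by gcongr
      linarith
    have h7 : α * (μ / 2 * ‖x - zs‖ ^ 2) ≤ α * (F zs - F x - inner ℝ (D x) (zs - x)) := by gcongr
    rw [h3] at h7
    linarith
  have h5 : x - α • d - zs = (x - zs - α • D x) - α • (d - D x) := by
    rw [smul_sub]; abel
  rw [h5]
  set P := x - zs - α • D x
  set Q := d - D x
  have h6 : ‖P - α • Q‖ ^ 2 ≤ (1 + α * μ / 2) * ‖P‖ ^ 2 + 3 * α / μ * ‖Q‖ ^ 2 := by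
    rw [norm_sub_sq_real, inner_smul_right, norm_smul, Real.norm_of_nonneg hα.le, mul_pow]
    have h7 : -inner ℝ P Q ≤ ‖P‖ * ‖Q‖ :=
      (neg_le_abs _).trans (abs_real_inner_le_norm P Q)
    have h8 : 2 * α * (‖P‖ * ‖Q‖) ≤ α * μ / 2 * ‖P‖ ^ 2 + 2 * α / μ * ‖Q‖ ^ 2 := by
      have h9 : α * μ / 2 * ‖P‖ ^ 2 + 2 * α / μ * ‖Q‖ ^ 2 - 2 * α * (‖P‖ * ‖Q‖) =
          α / (2 * μ) * (μ * ‖P‖ - 2 * ‖Q‖) ^ 2 := by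
        field_simp
        ring
      have h10 : 0 ≤ α / (2 * μ) * (μ * ‖P‖ - 2 * ‖Q‖) ^ 2 := by positivity
      linarith
    have h11 : α ^ 2 * ‖Q‖ ^ 2 ≤ α / μ * ‖Q‖ ^ 2 := by
      have : α ^ 2 ≤ α / μ := by
        rw [le_div_iff₀ hμ]
        nlinarith
      gcongr
    have h12 : 3 * α / μ * ‖Q‖ ^ 2 = 2 * α / μ * ‖Q‖ ^ 2 + α / μ * ‖Q‖ ^ 2 := by ring
    have h13 : 2 * α * -inner ℝ P Q ≤ 2 * α * (‖P‖ * ‖Q‖) := by gcongr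
    linarith
  have h7 : (1 + α * μ / 2) * ‖P‖ ^ 2 ≤ (1 + α * μ / 2) * ((1 - α * μ) * ‖x - zs‖ ^ 2) := by
    gcongr
  have h8 : (1 + α * μ / 2) * ((1 - α * μ) * ‖x - zs‖ ^ 2) ≤ (1 - α * μ / 2) * ‖x - zs‖ ^ 2 := by
    have : 0 ≤ (α * μ) ^ 2 * ‖x - zs‖ ^ 2 := by positivity
    linarith
  linarith

end Costs

/-! ### Averages and deviations over the nodes -/

section Norms

variable {n : ℕ} {E : Type*} [NormedAddCommGroup E] {v : Fin n → ℝ}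

lemma norm_sub_sub_sq_le (a b c : E) :
    ‖a - b - c‖ ^ 2 ≤ 3 * (‖a‖ ^ 2 + ‖b‖ ^ 2 + ‖c‖ ^ 2) := by
  have h : ‖a - b - c‖ ≤ ‖a‖ + ‖b‖ + ‖c‖ :=
    (norm_sub_le _ _).trans (by gcongr; exact norm_sub_le _ _)
  have h2 : ‖a - b - c‖ ^ 2 ≤ (‖a‖ + ‖b‖ + ‖c‖) ^ 2 := by gcongr
  nlinarith [sq_nonneg (‖a‖ - ‖b‖), sq_nonneg (‖b‖ - ‖c‖), sq_nonneg (‖a‖ - ‖c‖)]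

lemma weightedSq_nonneg (hv : ∀ i, 0 < v i) (u : Fin n → E) : 0 ≤ weightedSq v u :=
  Finset.sum_nonneg fun i _ => div_nonneg (sq_nonneg _) (hv i).le

/-- Convexity of the square: `‖a + b‖² ≤ ‖a‖² / (1 - s) + ‖b‖² / s`. -/
lemma weightedSq_add_le (hv : ∀ i, 0 < v i) {s : ℝ} (hs : 0 < s) (hs1 : s < 1)
    (u w : Fin n → E) :
    weightedSq v (u + w) ≤ weightedSq v u / (1 - s) + weightedSq v w / s := by
  have h1s : 0 < 1 - s := sub_pos.2 hs1
  have key : ∀ a b : E, ‖a + b‖ ^ 2 ≤ ‖a‖ ^ 2 / (1 - s) + ‖b‖ ^ 2 / s := by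
    intro a b
    have h1 : ‖a + b‖ ^ 2 ≤ (‖a‖ + ‖b‖) ^ 2 := by gcongr; exact norm_add_le _ _
    have h2 : ‖a‖ ^ 2 / (1 - s) + ‖b‖ ^ 2 / s - (‖a‖ + ‖b‖) ^ 2 =
        (s * ‖a‖ - (1 - s) * ‖b‖) ^ 2 / ((1 - s) * s) := by
      field_simp
      ring
    have h3 : 0 ≤ (s * ‖a‖ - (1 - s) * ‖b‖) ^ 2 / ((1 - s) * s) := by positivity
    linarith
  simp only [weightedSq, Finset.sum_div, ← Finset.sum_add_distrib]
  refine Finset.sum_le_sum fun i _ => ?_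
  calc ‖(u + w) i‖ ^ 2 / v i ≤ (‖u i‖ ^ 2 / (1 - s) + ‖w i‖ ^ 2 / s) / v i := by
        have := hv i
        gcongr
        exact key _ _
    _ = _ := by ring

lemma sum_norm_sq_le_iSup_mul (hv : ∀ i, 0 < v i) (u : Fin n → E) :
    ∑ i, ‖u i‖ ^ 2 ≤ (⨆ i, v i) * weightedSq v u := by
  rw [weightedSq, Finset.mul_sum]
  refine Finset.sum_le_sum fun i _ => ?_
  have h1 : v i ≤ ⨆ i, v i := le_ciSup (Finite.bddAbove_range v) i
  have h2 := hv i
  rw [mul_div_assoc', le_div_iff₀ h2, mul_comm]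
  gcongr

lemma weightedSq_le_sum_div_iInf (hv : 0 < ⨅ i, v i) (u : Fin n → E) :
    weightedSq v u ≤ (∑ i, ‖u i‖ ^ 2) / ⨅ i, v i := by
  rw [weightedSq, Finset.sum_div]
  refine Finset.sum_le_sum fun i _ => ?_
  have h1 : ⨅ i, v i ≤ v i := ciInf_le (Finite.bddBelow_range v) i
  gcongr

end Norms

section Nodes

variable {n : ℕ} {E : Type*} [NormedAddCommGroup E] [InnerProductSpace ℝ E]

/-- Average over the nodes. -/
noncomputable def avg (u : Fin n → E) : E := (n : ℝ)⁻¹ • ∑ i, u i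

/-- One mixing step `B ⊗ I`. -/
noncomputable def mix (B : Matrix (Fin n) (Fin n) ℝ) (u : Fin n → E) (i : Fin n) : E :=
  ∑ j, B i j • u j

/-- Deviation of `u` from its average spread along the weights `y`. If `∑ y i = n`, this is the
(oblique) projection onto the zero-sum families along `y ⊗ E`. -/
noncomputable def dev (y : Fin n → ℝ) (u : Fin n → E) (i : Fin n) : E := u i - y i • avg u

lemma avg_add (u w : Fin n → E) : avg (u + w) = avg u + avg w := by
  simp [avg, Finset.sum_add_distrib]

lemma avg_sub (u w : Fin n → E) : avg (u - w) = avg u - avg w := by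
  simp [avg, smul_sub]

lemma avg_smul (c : ℝ) (u : Fin n → E) : avg (c • u) = c • avg u := by
  simp [avg, ← Finset.smul_sum, smul_comm c]

lemma avg_mix {G : Digraph (Fin n)} {B : Matrix (Fin n) (Fin n) ℝ} (hB : IsWeightMatrix G B)
    (u : Fin n → E) : avg (mix B u) = avg u := by
  simp only [avg, mix]
  rw [Finset.sum_comm]
  simp_rw [← Finset.sum_smul, hB.col_sum, one_smul]

lemma dev_add (y : Fin n → ℝ) (u w : Fin n → E) : dev y (u + w) = dev y u + dev y w := by
  funext i
  simp only [dev, avg_add, Pi.add_apply, smul_add]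
  abel

lemma dev_sub (y : Fin n → ℝ) (u w : Fin n → E) : dev y (u - w) = dev y u - dev y w := by
  funext i
  simp only [dev, avg_sub, Pi.sub_apply, smul_sub]
  abel

lemma dev_smul (y : Fin n → ℝ) (c : ℝ) (u : Fin n → E) : dev y (c • u) = c • dev y u := by
  funext i
  simp only [dev, avg_smul, Pi.smul_apply, smul_sub, smul_comm c]

lemma dev_mix {G : Digraph (Fin n)} {B : Matrix (Fin n) (Fin n) ℝ} (hB : IsWeightMatrix G B)
    (k : ℕ) (u : Fin n → E) : dev (yVec B (k + 1)) (mix B u) = mix B (dev (yVec B k) u) := by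
  funext i
  simp only [dev, avg_mix hB, mix, yVec_succ_apply, smul_sub, Finset.sum_sub_distrib,
    Finset.sum_smul, smul_smul]

lemma sum_dev (hn : 0 < n) {y : Fin n → ℝ} (hy : ∑ i, y i = n) (u : Fin n → E) :
    ∑ i, dev y u i = 0 := by
  have : (n : ℝ) ≠ 0 := by positivity
  simp only [dev, Finset.sum_sub_distrib, ← Finset.sum_smul, hy]
  rw [avg, smul_inv_smul₀ this, sub_self]

lemma card_mul_norm_avg_sq_le (hn : 0 < n) (u : Fin n → E) :
    n * ‖avg u‖ ^ 2 ≤ ∑ i, ‖u i‖ ^ 2 := by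
  have hn' : (0 : ℝ) < n := by positivity
  rw [avg, norm_smul, mul_pow, norm_inv, Real.norm_of_nonneg hn'.le]
  have h1 : ‖∑ i, u i‖ ^ 2 ≤ n * ∑ i, ‖u i‖ ^ 2 := by
    calc ‖∑ i, u i‖ ^ 2 ≤ (∑ i, ‖u i‖) ^ 2 := by gcongr; exact norm_sum_le _ _
      _ ≤ _ := by simpa using sq_sum_le_card_mul_sum_sq (s := Finset.univ) (f := fun i => ‖u i‖)
  calc n * ((n : ℝ)⁻¹ ^ 2 * ‖∑ i, u i‖ ^ 2)
      ≤ n * ((n : ℝ)⁻¹ ^ 2 * (n * ∑ i, ‖u i‖ ^ 2)) := by gcongr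
    _ = ∑ i, ‖u i‖ ^ 2 := by field_simp

lemma norm_add_sq_le_two (a b : E) : ‖a + b‖ ^ 2 ≤ 2 * ‖a‖ ^ 2 + 2 * ‖b‖ ^ 2 := by
  have := parallelogram_law_with_norm ℝ a b
  nlinarith [sq_nonneg ‖a - b‖]

lemma norm_sub_sq_le_two (a b : E) : ‖a - b‖ ^ 2 ≤ 2 * ‖a‖ ^ 2 + 2 * ‖b‖ ^ 2 := by
  simpa [sub_eq_add_neg] using norm_add_sq_le_two a (-b)

variable {v : Fin n → ℝ}

lemma weightedSq_smul (c : ℝ) (u : Fin n → E) :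
    weightedSq v (c • u) = c ^ 2 * weightedSq v u := by
  simp [weightedSq, norm_smul, mul_pow, Finset.mul_sum, mul_div_assoc]

/-- The oblique projection `dev y` is bounded by `2 sup y`. -/
lemma sum_norm_dev_sq_le (hn : 0 < n) {y : Fin n → ℝ} {c : ℝ} (hc : 1 ≤ c)
    (hy : ∀ i, 0 ≤ y i) (hyc : ∀ i, y i ≤ c) (u : Fin n → E) :
    ∑ i, ‖dev y u i‖ ^ 2 ≤ 4 * c ^ 2 * ∑ i, ‖u i‖ ^ 2 := by
  have h1 : ∀ i, ‖dev y u i‖ ^ 2 ≤ 2 * ‖u i‖ ^ 2 + 2 * (c ^ 2 * ‖avg u‖ ^ 2) := by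
    intro i
    refine (norm_sub_sq_le_two _ _).trans ?_
    rw [norm_smul, mul_pow, Real.norm_of_nonneg (hy i)]
    have := hy i
    gcongr
    exact hyc i
  have h2 := card_mul_norm_avg_sq_le hn u
  have h3 : 0 ≤ ∑ i, ‖u i‖ ^ 2 := by positivity
  calc ∑ i, ‖dev y u i‖ ^ 2 ≤ ∑ i, (2 * ‖u i‖ ^ 2 + 2 * (c ^ 2 * ‖avg u‖ ^ 2)) :=
        Finset.sum_le_sum fun i _ => h1 i
    _ = 2 * ∑ i, ‖u i‖ ^ 2 + 2 * (c ^ 2 * (n * ‖avg u‖ ^ 2)) := by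
        rw [Finset.sum_add_distrib, ← Finset.mul_sum]
        simp
        ring
    _ ≤ 2 * (c ^ 2 * ∑ i, ‖u i‖ ^ 2) + 2 * (c ^ 2 * ∑ i, ‖u i‖ ^ 2) := by
        gcongr
        exact le_mul_of_one_le_left h3 (one_le_pow₀ hc)
    _ = _ := by ring

/-- Costs with quadratic bounds average to a cost with quadratic bounds. -/
lemma hasQuadraticBounds_globalCost {p : ℕ} (hn : 0 < n) {μ ℓ : ℝ}
    {f : Fin n → EuclideanSpace ℝ (Fin p) → ℝ} (hf : ∀ i, IsStronglyConvexSmooth μ ℓ (f i)) :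
    HasQuadraticBounds μ ℓ (globalCost f) (fun x => avg fun i => gradient (f i) x) := by
  have hn' : (n : ℝ) ≠ 0 := by positivity
  have key : ∀ x y, globalCost f y - globalCost f x -
      inner ℝ (avg fun i => gradient (f i) x) (y - x) =
      (n : ℝ)⁻¹ * ∑ i, (f i y - f i x - inner ℝ (gradient (f i) x) (y - x)) := by
    intro x y
    simp only [globalCost, avg, real_inner_smul_left, sum_inner, Finset.sum_sub_distrib, one_div]
    ring
  have hc : ∀ c : ℝ, c = (n : ℝ)⁻¹ * ∑ _i : Fin n, c := by
    intro c
    simp [hn']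
  constructor
  · intro x y
    rw [key, hc (μ / 2 * ‖x - y‖ ^ 2)]
    gcongr with i
    exact (hf i).lower x y
  · intro x y
    rw [key, hc (ℓ / 2 * ‖x - y‖ ^ 2)]
    gcongr with i
    exact (hf i).upper x y

end Nodes

/-! ### Pathwise recursions of the consensus and tracking errors -/

section Pathwise

variable {n p : ℕ} {G : Digraph (Fin n)} {B : Matrix (Fin n) (Fin n) ℝ} {v : Fin n → ℝ}
  {α : ℝ} {x₀ : Fin n → EuclideanSpace ℝ (Fin p)}
  {S : ℕ → Fin n → EuclideanSpace ℝ (Fin p) → EuclideanSpace ℝ (Fin p)}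

/-- The stochastic gradients that the nodes receive at iteration `k`. -/
noncomputable def sample (B : Matrix (Fin n) (Fin n) ℝ) (α : ℝ)
    (x₀ : Fin n → EuclideanSpace ℝ (Fin p))
    (S : ℕ → Fin n → EuclideanSpace ℝ (Fin p) → EuclideanSpace ℝ (Fin p)) (k : ℕ) (i : Fin n) :
    EuclideanSpace ℝ (Fin p) :=
  S k i ((iterate B α x₀ S k).z i)

lemma iterate_x_succ (k : ℕ) : (iterate B α x₀ S (k + 1)).x =
    mix B (iterate B α x₀ S k).x - α • (iterate B α x₀ S k).w := rfl

lemma iterate_w_succ (k : ℕ) : (iterate B α x₀ S (k + 1)).w =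
    mix B (iterate B α x₀ S k).w + (sample B α x₀ S (k + 1) - sample B α x₀ S k) := by
  funext i
  exact add_sub_assoc _ _ _

lemma iterate_y (k : ℕ) : (iterate B α x₀ S k).y = yVec B k := by
  induction k with
  | zero => rfl
  | succ k ih =>
    funext i
    rw [yVec_succ_apply, ← ih]
    rfl

lemma iterate_z (k : ℕ) (i : Fin n) : (iterate B α x₀ S k).z i =
    (yVec B k i)⁻¹ • (iterate B α x₀ S k).x i := by
  cases k with
  | zero => simp [iterate, yVec]
  | succ k =>
    rw [← iterate_y (α := α) (x₀ := x₀) (S := S)]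
    rfl

/-- Gradient tracking: the average of the `w i` is the average of the current samples. -/
lemma avg_iterate_w (hB : IsWeightMatrix G B) (k : ℕ) :
    avg (iterate B α x₀ S k).w = avg (sample B α x₀ S k) := by
  induction k with
  | zero => rfl
  | succ k ih => rw [iterate_w_succ, avg_add, avg_sub, avg_mix hB, ih, add_sub_cancel]

lemma avg_iterate_x_succ (hB : IsWeightMatrix G B) (k : ℕ) :
    avg (iterate B α x₀ S (k + 1)).x =
      avg (iterate B α x₀ S k).x - α • avg (sample B α x₀ S k) := by
  rw [iterate_x_succ, avg_sub, avg_smul, avg_mix hB, avg_iterate_w hB]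

lemma dev_iterate_x_succ (hB : IsWeightMatrix G B) (k : ℕ) :
    dev (yVec B (k + 1)) (iterate B α x₀ S (k + 1)).x =
      mix B (dev (yVec B k) (iterate B α x₀ S k).x) -
        α • dev (yVec B (k + 1)) (iterate B α x₀ S k).w := by
  rw [iterate_x_succ, dev_sub, dev_smul, dev_mix hB]

lemma dev_iterate_w_succ (hB : IsWeightMatrix G B) (k : ℕ) :
    dev (yVec B (k + 2)) (iterate B α x₀ S (k + 1)).w =
      mix B (dev (yVec B (k + 1)) (iterate B α x₀ S k).w) +
        dev (yVec B (k + 2)) (sample B α x₀ S (k + 1) - sample B α x₀ S k) := by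
  rw [iterate_w_succ, dev_add, dev_mix hB]

lemma iterate_z_eq (hB : IsWeightMatrix G B) (hv : IsPerronVector B v) (k : ℕ) (i : Fin n) :
    (iterate B α x₀ S k).z i = avg (iterate B α x₀ S k).x +
      (yVec B k i)⁻¹ • dev (yVec B k) (iterate B α x₀ S k).x i := by
  rw [iterate_z, dev, smul_sub, inv_smul_smul₀ (yVec_pos hB hv k i).ne', add_sub_cancel]

/-- Weighted square of a family of vectors, rescaled so that it dominates the plain squared norm
of the family divided entrywise by any `y_k`. -/
noncomputable def scaledSq (B : Matrix (Fin n) (Fin n) ℝ) (v : Fin n → ℝ)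
    (u : Fin n → EuclideanSpace ℝ (Fin p)) : ℝ :=
  yInvSup B ^ 2 * ((⨆ i, v i) * weightedSq v u)

/-- Consensus error: size of the deviation of the `x i` from their average, spread along `y_k`. -/
noncomputable def consensusErr (B : Matrix (Fin n) (Fin n) ℝ) (v : Fin n → ℝ) (α : ℝ)
    (x₀ : Fin n → EuclideanSpace ℝ (Fin p))
    (S : ℕ → Fin n → EuclideanSpace ℝ (Fin p) → EuclideanSpace ℝ (Fin p)) (k : ℕ) : ℝ :=
  scaledSq B v (dev (yVec B k) (iterate B α x₀ S k).x)

/-- Tracking error: size of the deviation of the `w i` from their average. The average is spread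
along `y_{k+1}`, not `y_k`: this is the choice for which the recursion of the consensus error is
exact. -/
noncomputable def trackingErr (B : Matrix (Fin n) (Fin n) ℝ) (v : Fin n → ℝ) (α : ℝ)
    (x₀ : Fin n → EuclideanSpace ℝ (Fin p))
    (S : ℕ → Fin n → EuclideanSpace ℝ (Fin p) → EuclideanSpace ℝ (Fin p)) (k : ℕ) : ℝ :=
  scaledSq B v (dev (yVec B (k + 1)) (iterate B α x₀ S k).w)

/-- Optimality error of the average, summed over the nodes. -/
noncomputable def optErr (B : Matrix (Fin n) (Fin n) ℝ) (α : ℝ)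
    (x₀ : Fin n → EuclideanSpace ℝ (Fin p))
    (S : ℕ → Fin n → EuclideanSpace ℝ (Fin p) → EuclideanSpace ℝ (Fin p))
    (zs : EuclideanSpace ℝ (Fin p)) (k : ℕ) : ℝ :=
  n * ‖avg (iterate B α x₀ S k).x - zs‖ ^ 2

/-- Error of the sample of node `i` at iteration `k`. -/
noncomputable def sampleErr (B : Matrix (Fin n) (Fin n) ℝ) (α : ℝ)
    (x₀ : Fin n → EuclideanSpace ℝ (Fin p))
    (S : ℕ → Fin n → EuclideanSpace ℝ (Fin p) → EuclideanSpace ℝ (Fin p))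
    (f : Fin n → EuclideanSpace ℝ (Fin p) → ℝ) (k : ℕ) (i : Fin n) : EuclideanSpace ℝ (Fin p) :=
  sample B α x₀ S k i - gradient (f i) ((iterate B α x₀ S k).z i)

lemma scaledSq_nonneg (hn : 0 < n) (hv : IsPerronVector B v)
    (u : Fin n → EuclideanSpace ℝ (Fin p)) : 0 ≤ scaledSq B v u := by
  have h1 := (iSup_perron_pos hn hv).le
  have h2 := weightedSq_nonneg hv.pos u
  unfold scaledSq
  positivity

lemma scaledSq_smul (c : ℝ) (u : Fin n → EuclideanSpace ℝ (Fin p)) :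
    scaledSq B v (c • u) = c ^ 2 * scaledSq B v u := by
  rw [scaledSq, weightedSq_smul, scaledSq]
  ring

lemma scaledSq_add_le (hn : 0 < n) (hv : IsPerronVector B v) {s : ℝ} (hs : 0 < s) (hs1 : s < 1)
    (u w : Fin n → EuclideanSpace ℝ (Fin p)) :
    scaledSq B v (u + w) ≤ scaledSq B v u / (1 - s) + scaledSq B v w / s := by
  have h1 := (iSup_perron_pos hn hv).le
  calc scaledSq B v (u + w) ≤
      yInvSup B ^ 2 * ((⨆ i, v i) * (weightedSq v u / (1 - s) + weightedSq v w / s)) := by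
        unfold scaledSq
        gcongr
        exact weightedSq_add_le hv.pos hs hs1 u w
    _ = _ := by unfold scaledSq; ring

lemma scaledSq_mix_le (hn : 0 < n) (hv : IsPerronVector B v)
    {u : Fin n → EuclideanSpace ℝ (Fin p)} (hu : ∑ i, u i = 0) :
    scaledSq B v (mix B u) ≤ sigmaB B v ^ 2 * scaledSq B v u := by
  have h1 := (iSup_perron_pos hn hv).le
  calc scaledSq B v (mix B u) ≤
      yInvSup B ^ 2 * ((⨆ i, v i) * (sigmaB B v ^ 2 * weightedSq v u)) := by
        unfold scaledSq
        gcongr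
        exact weightedSq_mix_le hv hu
    _ = _ := by unfold scaledSq; ring

/-- Mixing a zero-sum family and adding a perturbation: with `λ = 1 - σ_B²`, the contraction is
kept up to a factor `1 - λ/2`. -/
lemma scaledSq_mix_add_le (hn : 0 < n) (hv : IsPerronVector B v) (hσ : sigmaB B v < 1)
    {u : Fin n → EuclideanSpace ℝ (Fin p)} (hu : ∑ i, u i = 0)
    (w : Fin n → EuclideanSpace ℝ (Fin p)) :
    scaledSq B v (mix B u + w) ≤ (1 - (1 - sigmaB B v ^ 2) / 2) * scaledSq B v u +
      2 / (1 - sigmaB B v ^ 2) * scaledSq B v w := by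
  have hl := one_sub_sigmaB_sq_pos hσ
  have h1 := scaledSq_mix_le hn hv hu
  have hu0 := scaledSq_nonneg hn hv u
  set l := 1 - sigmaB B v ^ 2 with hldef
  have hl1 : l ≤ 1 := by rw [hldef]; nlinarith
  have h2 := scaledSq_add_le hn hv (by positivity : 0 < l / 2) (by linarith) (mix B u) w
  have h3 : scaledSq B v (mix B u) / (1 - l / 2) ≤ (1 - l / 2) * scaledSq B v u := by
    rw [div_le_iff₀ (by linarith)]
    have h4 : sigmaB B v ^ 2 = 1 - l := by rw [hldef]; ring
    rw [h4] at h1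
    nlinarith [mul_nonneg (sq_nonneg l) hu0]
  have h5 : scaledSq B v w / (l / 2) = 2 / l * scaledSq B v w := by
    field_simp
  linarith

lemma sum_norm_inv_yVec_smul_sq_le (hn : 0 < n) (hB : IsWeightMatrix G B)
    (hv : IsPerronVector B v) (k : ℕ) (u : Fin n → EuclideanSpace ℝ (Fin p)) :
    ∑ i, ‖(yVec B k i)⁻¹ • u i‖ ^ 2 ≤ scaledSq B v u := by
  have h1 := one_le_yInvSup hn hB hv
  calc ∑ i, ‖(yVec B k i)⁻¹ • u i‖ ^ 2 ≤ ∑ i, yInvSup B ^ 2 * ‖u i‖ ^ 2 := by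
        refine Finset.sum_le_sum fun i _ => ?_
        have h2 := inv_nonneg.2 (yVec_pos hB hv k i).le
        rw [norm_smul, mul_pow, Real.norm_of_nonneg h2]
        gcongr
        exact inv_yVec_le_yInvSup hB hv k i
    _ = yInvSup B ^ 2 * ∑ i, ‖u i‖ ^ 2 := by rw [Finset.mul_sum]
    _ ≤ _ := by
        unfold scaledSq
        gcongr
        exact sum_norm_sq_le_iSup_mul hv.pos u

lemma scaledSq_dev_le (hn : 0 < n) (hB : IsWeightMatrix G B)
    (hv : IsPerronVector B v) (k : ℕ) (u : Fin n → EuclideanSpace ℝ (Fin p)) :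
    scaledSq B v (dev (yVec B k) u) ≤
      4 * (yInvSup B ^ 2 * ySup B ^ 2 * hRatio v) * ∑ i, ‖u i‖ ^ 2 := by
  have h1 := (iSup_perron_pos hn hv).le
  have h2 := iInf_perron_pos hn hv
  calc scaledSq B v (dev (yVec B k) u)
      ≤ yInvSup B ^ 2 * ((⨆ i, v i) *
          ((4 * ySup B ^ 2 * ∑ i, ‖u i‖ ^ 2) / ⨅ i, v i)) := by
        unfold scaledSq
        gcongr
        refine (weightedSq_le_sum_div_iInf h2 _).trans ?_
        gcongr
        exact sum_norm_dev_sq_le hn (one_le_ySup hn hB hv) (fun i => (yVec_pos hB hv k i).le)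
          (fun i => yVec_le_ySup hB hv k i) u
    _ = _ := by unfold hRatio; ring

lemma consensusErr_nonneg (hn : 0 < n) (hv : IsPerronVector B v) (k : ℕ) :
    0 ≤ consensusErr B v α x₀ S k := scaledSq_nonneg hn hv _

lemma consensusErr_succ_le (hn : 0 < n) (hB : IsWeightMatrix G B) (hv : IsPerronVector B v)
    (hσ : sigmaB B v < 1) (k : ℕ) :
    consensusErr B v α x₀ S (k + 1) ≤
      (1 - (1 - sigmaB B v ^ 2) / 2) * consensusErr B v α x₀ S k +
        2 / (1 - sigmaB B v ^ 2) * α ^ 2 * trackingErr B v α x₀ S k := by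
  have h := scaledSq_mix_add_le hn hv hσ
    (sum_dev hn (sum_yVec hB k) (iterate B α x₀ S k).x)
    ((-α) • dev (yVec B (k + 1)) (iterate B α x₀ S k).w)
  rw [neg_smul, ← sub_eq_add_neg, ← dev_iterate_x_succ hB, ← neg_smul, scaledSq_smul, neg_sq,
    ← mul_assoc] at h
  exact h

/-- A cruder bound on the consensus error, free of the factor `1 / λ`. -/
lemma consensusErr_succ_le_two (hn : 0 < n) (hB : IsWeightMatrix G B) (hv : IsPerronVector B v)
    (hσ : sigmaB B v < 1) (k : ℕ) :
    consensusErr B v α x₀ S (k + 1) ≤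
      2 * consensusErr B v α x₀ S k + 2 * α ^ 2 * trackingErr B v α x₀ S k := by
  have h := scaledSq_add_le hn hv (by norm_num : (0 : ℝ) < 1 / 2) (by norm_num)
    (mix B (dev (yVec B k) (iterate B α x₀ S k).x))
    ((-α) • dev (yVec B (k + 1)) (iterate B α x₀ S k).w)
  rw [neg_smul, ← sub_eq_add_neg, ← dev_iterate_x_succ hB, ← neg_smul, scaledSq_smul,
    neg_sq] at h
  have h1 := scaledSq_mix_le hn hv (sum_dev hn (sum_yVec hB k) (iterate B α x₀ S k).x)
  have h2 : sigmaB B v ^ 2 * consensusErr B v α x₀ S k ≤ 1 * consensusErr B v α x₀ S k := by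
    gcongr
    · exact consensusErr_nonneg hn hv k
    · exact pow_le_one₀ sigmaB_nonneg hσ.le
  have h3 : (1 : ℝ) - 1 / 2 = 1 / 2 := by norm_num
  rw [h3, div_div_eq_mul_div, div_div_eq_mul_div, div_one, div_one] at h
  simp only [consensusErr, trackingErr] at h2 ⊢
  linarith

lemma trackingErr_succ_le (hn : 0 < n) (hB : IsWeightMatrix G B) (hv : IsPerronVector B v)
    (hσ : sigmaB B v < 1) (k : ℕ) :
    trackingErr B v α x₀ S (k + 1) ≤
      (1 - (1 - sigmaB B v ^ 2) / 2) * trackingErr B v α x₀ S k +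
        2 / (1 - sigmaB B v ^ 2) * (4 * (yInvSup B ^ 2 * ySup B ^ 2 * hRatio v) *
          ∑ i, ‖sample B α x₀ S (k + 1) i - sample B α x₀ S k i‖ ^ 2) := by
  have hl := one_sub_sigmaB_sq_pos hσ
  have h := scaledSq_mix_add_le hn hv hσ
    (sum_dev hn (sum_yVec hB (k + 1)) (iterate B α x₀ S k).w)
    (dev (yVec B (k + 2)) (sample B α x₀ S (k + 1) - sample B α x₀ S k))
  rw [← dev_iterate_w_succ hB] at h
  refine h.trans ?_
  rw [trackingErr]
  gcongr
  exact scaledSq_dev_le hn hB hv (k + 2) _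

lemma sum_norm_z_sub_avg_sq_le (hn : 0 < n) (hB : IsWeightMatrix G B) (hv : IsPerronVector B v)
    (k : ℕ) :
    ∑ i, ‖(iterate B α x₀ S k).z i - avg (iterate B α x₀ S k).x‖ ^ 2 ≤
      consensusErr B v α x₀ S k := by
  simp_rw [iterate_z_eq hB hv k, add_sub_cancel_left]
  exact sum_norm_inv_yVec_smul_sq_le hn hB hv k _

lemma sum_norm_z_sub_sq_le (hn : 0 < n) (hB : IsWeightMatrix G B) (hv : IsPerronVector B v)
    (zs : EuclideanSpace ℝ (Fin p)) (k : ℕ) :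
    ∑ i, ‖(iterate B α x₀ S k).z i - zs‖ ^ 2 ≤
      2 * consensusErr B v α x₀ S k + 2 * optErr B α x₀ S zs k := by
  have h1 : ∀ i, ‖(iterate B α x₀ S k).z i - zs‖ ^ 2 ≤
      2 * ‖(iterate B α x₀ S k).z i - avg (iterate B α x₀ S k).x‖ ^ 2 +
        2 * ‖avg (iterate B α x₀ S k).x - zs‖ ^ 2 := by
    intro i
    rw [← sub_add_sub_cancel _ (avg (iterate B α x₀ S k).x) zs]
    exact norm_add_sq_le_two _ _
  refine (Finset.sum_le_sum fun i _ => h1 i).trans ?_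
  rw [Finset.sum_add_distrib, ← Finset.mul_sum, optErr]
  have := sum_norm_z_sub_avg_sq_le (α := α) (x₀ := x₀) (S := S) hn hB hv k
  simp only [Finset.sum_const, Finset.card_univ, Fintype.card_fin, nsmul_eq_mul]
  linarith

lemma sum_norm_z_succ_sub_sq_le (hn : 0 < n) (hB : IsWeightMatrix G B) (hv : IsPerronVector B v)
    (hσ : sigmaB B v < 1) (k : ℕ) :
    ∑ i, ‖(iterate B α x₀ S (k + 1)).z i - (iterate B α x₀ S k).z i‖ ^ 2 ≤
      9 * consensusErr B v α x₀ S k + 6 * α ^ 2 * trackingErr B v α x₀ S k +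
        3 * α ^ 2 * (n * ‖avg (sample B α x₀ S k)‖ ^ 2) := by
  have h1 : ∀ i, (iterate B α x₀ S (k + 1)).z i - (iterate B α x₀ S k).z i =
      (yVec B (k + 1) i)⁻¹ • dev (yVec B (k + 1)) (iterate B α x₀ S (k + 1)).x i -
        (yVec B k i)⁻¹ • dev (yVec B k) (iterate B α x₀ S k).x i -
          α • avg (sample B α x₀ S k) := by
    intro i
    rw [iterate_z_eq hB hv, iterate_z_eq hB hv, avg_iterate_x_succ hB]
    abel
  have h2 := sum_norm_inv_yVec_smul_sq_le hn hB hv k (dev (yVec B k) (iterate B α x₀ S k).x)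
  have h3 := sum_norm_inv_yVec_smul_sq_le hn hB hv (k + 1)
    (dev (yVec B (k + 1)) (iterate B α x₀ S (k + 1)).x)
  have h4 := consensusErr_succ_le_two (α := α) (x₀ := x₀) (S := S) hn hB hv hσ k
  simp_rw [h1]
  refine (Finset.sum_le_sum fun i _ => norm_sub_sub_sq_le _ _ _).trans ?_
  rw [← Finset.mul_sum, Finset.sum_add_distrib, Finset.sum_add_distrib]
  simp only [Finset.sum_const, Finset.card_univ, Fintype.card_fin, nsmul_eq_mul, norm_smul α,
    mul_pow, Real.norm_eq_abs, sq_abs]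
  simp only [consensusErr] at h4 ⊢
  linarith

section Costs

variable {f : Fin n → EuclideanSpace ℝ (Fin p) → ℝ} {μ ℓ : ℝ} {zs : EuclideanSpace ℝ (Fin p)}

/-- The average of the local gradients at the `z i` is a good approximation of the gradient of
the global cost at the average of the `x i`. -/
lemma card_mul_norm_avg_gradient_sub_sq_le (hn : 0 < n) (hB : IsWeightMatrix G B)
    (hv : IsPerronVector B v) (hμ : 0 < μ) (hℓ : 0 < ℓ)
    (hf : ∀ i, IsStronglyConvexSmooth μ ℓ (f i)) (k : ℕ) :
    n * ‖(avg fun i => gradient (f i) ((iterate B α x₀ S k).z i)) -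
        avg (fun i => gradient (f i) (avg (iterate B α x₀ S k).x))‖ ^ 2 ≤
      ℓ ^ 2 * consensusErr B v α x₀ S k := by
  rw [← avg_sub]
  refine (card_mul_norm_avg_sq_le hn _).trans ?_
  calc _ ≤ ∑ i, ℓ ^ 2 * ‖(iterate B α x₀ S k).z i - avg (iterate B α x₀ S k).x‖ ^ 2 := by
        refine Finset.sum_le_sum fun i _ => ?_
        rw [← mul_pow]
        gcongr
        exact (hf i).hasQuadraticBounds.norm_sub_le hμ.le hℓ _ _
    _ ≤ _ := by
        rw [← Finset.mul_sum]
        gcongr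
        exact sum_norm_z_sub_avg_sq_le hn hB hv k

lemma avg_sample (k : ℕ) : avg (sample B α x₀ S k) =
    (avg fun i => gradient (f i) ((iterate B α x₀ S k).z i)) +
      avg (sampleErr B α x₀ S f k) := by
  rw [← avg_add]
  congr 1
  funext i
  simp [sampleErr]

lemma card_mul_norm_avg_sample_sq_le (hn : 0 < n) (hB : IsWeightMatrix G B)
    (hv : IsPerronVector B v) (hμ : 0 < μ) (hℓ : 0 < ℓ)
    (hf : ∀ i, IsStronglyConvexSmooth μ ℓ (f i))
    (hz : ∀ z, globalCost f zs ≤ globalCost f z) (k : ℕ) :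
    n * ‖avg (sample B α x₀ S k)‖ ^ 2 ≤
      4 * ℓ ^ 2 * (consensusErr B v α x₀ S k + optErr B α x₀ S zs k) +
        2 * ∑ i, ‖sampleErr B α x₀ S f k i‖ ^ 2 := by
  have hF := hasQuadraticBounds_globalCost hn hf
  set X := avg (iterate B α x₀ S k).x with hX
  set g := avg fun i => gradient (f i) ((iterate B α x₀ S k).z i) with hg
  set D := avg fun i => gradient (f i) X with hD
  have h1 : ‖D‖ ≤ ℓ * ‖X - zs‖ := by
    have h2 := hF.norm_sub_le hμ.le hℓ X zs
    have h3 : (avg fun i => gradient (f i) zs) = 0 := hF.eq_zero hℓ hz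
    rwa [h3, sub_zero] at h2
  have h2 : n * ‖D‖ ^ 2 ≤ ℓ ^ 2 * optErr B α x₀ S zs k := by
    rw [optErr, mul_left_comm, ← mul_pow]
    gcongr
  have h3 := card_mul_norm_avg_gradient_sub_sq_le (α := α) (x₀ := x₀) (S := S) hn hB hv hμ hℓ hf k
  have h4 := card_mul_norm_avg_sq_le hn (sampleErr B α x₀ S f k)
  have h5 : ‖g‖ ^ 2 ≤ 2 * ‖g - D‖ ^ 2 + 2 * ‖D‖ ^ 2 := by
    simpa using norm_add_sq_le_two (g - D) D
  have h6 : n * ‖g‖ ^ 2 ≤ n * (2 * ‖g - D‖ ^ 2 + 2 * ‖D‖ ^ 2) := by gcongr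
  have h7 : n * ‖g + avg (sampleErr B α x₀ S f k)‖ ^ 2 ≤
      n * (2 * ‖g‖ ^ 2 + 2 * ‖avg (sampleErr B α x₀ S f k)‖ ^ 2) := by
    gcongr
    exact norm_add_sq_le_two _ _
  rw [avg_sample (f := f)]
  linarith

/-- One step of the tracking error. The sample errors enter quadratically, so that no correlation
between them and the state matters here. -/
lemma trackingErr_succ_le_of_costs (hn : 0 < n) (hB : IsWeightMatrix G B)
    (hv : IsPerronVector B v) (hσ : sigmaB B v < 1) (hμ : 0 < μ) (hℓ : 0 < ℓ)
    (hf : ∀ i, IsStronglyConvexSmooth μ ℓ (f i))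
    (hz : ∀ z, globalCost f zs ≤ globalCost f z) (k : ℕ) :
    trackingErr B v α x₀ S (k + 1) ≤
      (1 - (1 - sigmaB B v ^ 2) / 2) * trackingErr B v α x₀ S k +
        8 * (yInvSup B ^ 2 * ySup B ^ 2 * hRatio v) / (1 - sigmaB B v ^ 2) *
          (2 * ℓ ^ 2 * (9 * consensusErr B v α x₀ S k + 6 * α ^ 2 * trackingErr B v α x₀ S k +
            12 * α ^ 2 * ℓ ^ 2 * (consensusErr B v α x₀ S k + optErr B α x₀ S zs k) +
            6 * α ^ 2 * ∑ i, ‖sampleErr B α x₀ S f k i‖ ^ 2) +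
          4 * ∑ i, ‖sampleErr B α x₀ S f (k + 1) i‖ ^ 2 +
          4 * ∑ i, ‖sampleErr B α x₀ S f k i‖ ^ 2) := by
  have hl := one_sub_sigmaB_sq_pos hσ
  have hh := one_le_hRatio hn hv
  have h1 : ∀ i, ‖sample B α x₀ S (k + 1) i - sample B α x₀ S k i‖ ^ 2 ≤
      2 * ℓ ^ 2 * ‖(iterate B α x₀ S (k + 1)).z i - (iterate B α x₀ S k).z i‖ ^ 2 +
        (4 * ‖sampleErr B α x₀ S f (k + 1) i‖ ^ 2 + 4 * ‖sampleErr B α x₀ S f k i‖ ^ 2) := by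
    intro i
    have h2 : sample B α x₀ S (k + 1) i - sample B α x₀ S k i =
        (gradient (f i) ((iterate B α x₀ S (k + 1)).z i) -
          gradient (f i) ((iterate B α x₀ S k).z i)) +
        (sampleErr B α x₀ S f (k + 1) i - sampleErr B α x₀ S f k i) := by
      simp only [sampleErr]
      abel
    have h3 := (hf i).hasQuadraticBounds.norm_sub_le hμ.le hℓ
      ((iterate B α x₀ S (k + 1)).z i) ((iterate B α x₀ S k).z i)
    have h4 := norm_sub_sq_le_two (sampleErr B α x₀ S f (k + 1) i) (sampleErr B α x₀ S f k i)
    have h5 := pow_le_pow_left₀ (norm_nonneg _) h3 2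
    rw [mul_pow] at h5
    rw [h2]
    refine (norm_add_sq_le_two _ _).trans ?_
    linarith
  have h2 := Finset.sum_le_sum fun i (_ : i ∈ Finset.univ) => h1 i
  rw [Finset.sum_add_distrib, Finset.sum_add_distrib, ← Finset.mul_sum, ← Finset.mul_sum,
    ← Finset.mul_sum] at h2
  have h3 := sum_norm_z_succ_sub_sq_le (α := α) (x₀ := x₀) (S := S) hn hB hv hσ k
  have h4 := card_mul_norm_avg_sample_sq_le (α := α) (x₀ := x₀) (S := S) hn hB hv hμ hℓ hf hz k
  have h5 : 3 * α ^ 2 * (n * ‖avg (sample B α x₀ S k)‖ ^ 2) ≤ 3 * α ^ 2 *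
      (4 * ℓ ^ 2 * (consensusErr B v α x₀ S k + optErr B α x₀ S zs k) +
        2 * ∑ i, ‖sampleErr B α x₀ S f k i‖ ^ 2) := by gcongr
  have h6 : 2 * ℓ ^ 2 * ∑ i, ‖(iterate B α x₀ S (k + 1)).z i - (iterate B α x₀ S k).z i‖ ^ 2 ≤
      2 * ℓ ^ 2 * (9 * consensusErr B v α x₀ S k + 6 * α ^ 2 * trackingErr B v α x₀ S k +
        3 * α ^ 2 *
      (4 * ℓ ^ 2 * (consensusErr B v α x₀ S k + optErr B α x₀ S zs k) +
        2 * ∑ i, ‖sampleErr B α x₀ S f k i‖ ^ 2)) := by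
    gcongr
    linarith
  refine (trackingErr_succ_le hn hB hv hσ k).trans ?_
  have h7 : ∀ H s : ℝ, 2 / (1 - sigmaB B v ^ 2) * (4 * H * s) =
      8 * H / (1 - sigmaB B v ^ 2) * s := fun H s => by ring
  rw [h7]
  gcongr
  linarith

end Costs

end Pathwise

/-! ### The linear system of error inequalities -/

/-- Comparison principle for a nonnegative system of three inequalities: a positive
subinvariant vector `(v₁, v₂, v₃)` with factor `γ` and a supersolution `(u₁, u₂, u₃)` bound every
solution by `M γ^k v + u`. -/
lemma exists_le_geometric_add {a b c : ℕ → ℝ} {A₁ A₃ B₁ B₂ C₁ C₂ C₃ r s γ : ℝ}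
    {v₁ v₂ v₃ u₁ u₂ u₃ : ℝ}
    (hA₁ : 0 ≤ A₁) (hA₃ : 0 ≤ A₃) (hB₁ : 0 ≤ B₁) (hB₂ : 0 ≤ B₂) (hC₁ : 0 ≤ C₁) (hC₂ : 0 ≤ C₂)
    (hC₃ : 0 ≤ C₃) (hγ : 0 ≤ γ)
    (ha : ∀ k, a (k + 1) ≤ A₁ * a k + A₃ * c k)
    (hb : ∀ k, b (k + 1) ≤ B₁ * a k + B₂ * b k + r)
    (hc : ∀ k, c (k + 1) ≤ C₁ * a k + C₂ * b k + C₃ * c k + s)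
    (hv₁ : 0 < v₁) (hv₂ : 0 < v₂) (hv₃ : 0 < v₃)
    (hva : A₁ * v₁ + A₃ * v₃ ≤ γ * v₁) (hvb : B₁ * v₁ + B₂ * v₂ ≤ γ * v₂)
    (hvc : C₁ * v₁ + C₂ * v₂ + C₃ * v₃ ≤ γ * v₃)
    (hu₁ : 0 ≤ u₁) (hu₂ : 0 ≤ u₂) (hu₃ : 0 ≤ u₃)
    (hua : A₁ * u₁ + A₃ * u₃ ≤ u₁) (hub : B₁ * u₁ + B₂ * u₂ + r ≤ u₂)
    (huc : C₁ * u₁ + C₂ * u₂ + C₃ * u₃ + s ≤ u₃) :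
    ∃ M, ∀ k, a k ≤ M * γ ^ k * v₁ + u₁ ∧ b k ≤ M * γ ^ k * v₂ + u₂ ∧
      c k ≤ M * γ ^ k * v₃ + u₃ := by
  have h0 : ∀ t w : ℝ, 0 < w → t ≤ |t| / w * w := fun t w hw => by
    rw [div_mul_cancel₀ _ hw.ne']
    exact le_abs_self t
  set M := |a 0| / v₁ + |b 0| / v₂ + |c 0| / v₃ with hM
  have hM0 : 0 ≤ M := by positivity
  have h1 : 0 ≤ |a 0| / v₁ := by positivity
  have h2 : 0 ≤ |b 0| / v₂ := by positivity
  have h3 : 0 ≤ |c 0| / v₃ := by positivity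
  refine ⟨M, fun k => ?_⟩
  induction k with
  | zero =>
    simp only [pow_zero, mul_one]
    refine ⟨?_, ?_, ?_⟩
    · have : |a 0| / v₁ * v₁ ≤ M * v₁ := by gcongr; linarith
      linarith [h0 (a 0) v₁ hv₁]
    · have : |b 0| / v₂ * v₂ ≤ M * v₂ := by gcongr; linarith
      linarith [h0 (b 0) v₂ hv₂]
    · have : |c 0| / v₃ * v₃ ≤ M * v₃ := by gcongr; linarith
      linarith [h0 (c 0) v₃ hv₃]
  | succ k ih =>
    obtain ⟨iha, ihb, ihc⟩ := ih
    have hN : 0 ≤ M * γ ^ k := by positivity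
    rw [pow_succ, ← mul_assoc]
    set N := M * γ ^ k
    refine ⟨?_, ?_, ?_⟩
    · have e1 := mul_le_mul_of_nonneg_left iha hA₁
      have e2 := mul_le_mul_of_nonneg_left ihc hA₃
      have e3 := mul_le_mul_of_nonneg_left hva hN
      linarith [ha k]
    · have e1 := mul_le_mul_of_nonneg_left iha hB₁
      have e2 := mul_le_mul_of_nonneg_left ihb hB₂
      have e3 := mul_le_mul_of_nonneg_left hvb hN
      linarith [hb k]
    · have e1 := mul_le_mul_of_nonneg_left iha hC₁
      have e2 := mul_le_mul_of_nonneg_left ihb hC₂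
      have e4 := mul_le_mul_of_nonneg_left ihc hC₃
      have e3 := mul_le_mul_of_nonneg_left hvc hN
      linarith [hc k]

section System

variable {lam α μ ℓ H : ℝ}

lemma mul_smooth_le_of_step (hl : 0 < lam) (hα : 0 < α) (hμ : 0 < μ) (hμℓ : μ ≤ ℓ) (hH : 1 ≤ H)
    (hstep : 2601 * (α ^ 2 * ℓ ^ 3 * H) ≤ μ * lam ^ 4) : 51 * (α * ℓ) ≤ lam ^ 2 := by
  have hℓ : 0 < ℓ := hμ.trans_le hμℓ
  refine le_of_sq_le_sq ?_ (by positivity)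
  have h1 : α ^ 2 * ℓ ^ 2 * μ * 1 ≤ α ^ 2 * ℓ ^ 2 * ℓ * H := by gcongr
  have h2 : μ * (51 * (α * ℓ)) ^ 2 ≤ μ * (lam ^ 2) ^ 2 := by linarith
  exact le_of_mul_le_mul_left h2 hμ

/-- The step-size condition makes the gains of all the loops of the system small: the consensus
error, the optimality error and the tracking error decay together at the rate `1 - α μ / 4` down
to a ball. -/
lemma consensus_add_opt_le {Q q : ℝ} {a b c : ℕ → ℝ} (hl : 0 < lam) (hl1 : lam ≤ 1) (hα : 0 < α)
    (hμ : 0 < μ) (hμℓ : μ ≤ ℓ) (hH : 1 ≤ H)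
    (hstep : 2601 * (α ^ 2 * ℓ ^ 3 * H) ≤ μ * lam ^ 4) (hq : 0 ≤ q) (hqQ : q ≤ Q)
    (ha : ∀ k, a (k + 1) ≤ (1 - lam / 2) * a k + 2 / lam * α ^ 2 * c k)
    (hb : ∀ k, b (k + 1) ≤ (1 - α * μ / 2) * b k + 3 * α / μ * (ℓ ^ 2 * a k) + α ^ 2 * q)
    (hc : ∀ k, c (k + 1) ≤ (1 - lam / 2) * c k + 8 * H / lam * (20 * ℓ ^ 2 * a k +
      12 * ℓ ^ 2 * α ^ 2 * c k + 24 * α ^ 2 * ℓ ^ 4 * b k + 9 * Q)) :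
    ∃ M, ∀ k, a k + b k ≤ M * (1 - α * μ / 4) ^ k +
      (21000 * (α ^ 2 * (H * Q) * ℓ ^ 2 / (μ ^ 2 * lam ^ 4)) + 2 * (α * q / μ)) := by
  have hℓ : 0 < ℓ := hμ.trans_le hμℓ
  have hQ : 0 ≤ Q := hq.trans hqQ
  have hαℓ := mul_smooth_le_of_step hl hα hμ hμℓ hH hstep
  have hαμ : α * μ ≤ α * ℓ := by gcongr
  have hll : lam ^ 2 ≤ lam := by nlinarith
  -- `X` and `Y` are the loop gains, relative to the contraction margin `lam`.
  set Y := α ^ 2 * ℓ ^ 3 * H / (μ * lam ^ 4) with hY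
  have hY1 : Y ≤ 1 / 2601 := by
    rw [hY, div_le_iff₀ (by positivity)]
    linarith
  have hY0 : 0 ≤ Y := by positivity
  set X := α ^ 2 * ℓ ^ 2 * H / lam ^ 4 with hX
  have hX0 : 0 ≤ X := by positivity
  have hXY : X ≤ Y := by
    have : Y = X * (ℓ / μ) := by rw [hX, hY]; field_simp
    rw [this]
    exact le_mul_of_one_le_right hX0 ((one_le_div hμ).2 hμℓ)
  have hY2 : Y ^ 2 ≤ 1 / 2601 * (1 / 2601) := by
    rw [sq]; gcongr
  have g1 : 8 * H / lam * (20 * ℓ ^ 2 * (5 * α ^ 2 / lam ^ 2)) = 800 * lam * X := by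
    rw [hX]; field_simp; ring
  have g2 : 8 * H / lam * (12 * ℓ ^ 2 * α ^ 2) ≤ 96 * lam * X := by
    have e1 : 8 * H / lam * (12 * ℓ ^ 2 * α ^ 2) = 96 * lam * X * lam ^ 2 := by
      rw [hX]; field_simp; ring
    rw [e1]
    exact mul_le_of_le_one_right (by positivity) (pow_le_one₀ hl.le hl1)
  have g3 : 8 * H / lam * (24 * α ^ 2 * ℓ ^ 4 * (12 * (ℓ / μ) ^ 2 * (5 * α ^ 2 / lam ^ 2))) ≤
      11520 * lam * Y ^ 2 := by
    have e1 : 8 * H / lam * (24 * α ^ 2 * ℓ ^ 4 * (12 * (ℓ / μ) ^ 2 * (5 * α ^ 2 / lam ^ 2))) =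
        11520 * lam * Y ^ 2 * (lam ^ 4 / H) := by
      rw [hY]; field_simp; ring
    rw [e1]
    refine mul_le_of_le_one_right (by positivity) ?_
    rw [div_le_one (by linarith)]
    exact (pow_le_one₀ hl.le hl1).trans hH
  -- Total gain of the tracking error fed back to itself: below `lam / 2` with a margin.
  have gain : 8 * H / lam * (20 * ℓ ^ 2 * (5 * α ^ 2 / lam ^ 2)) +
      8 * H / lam * (12 * ℓ ^ 2 * α ^ 2) +
      8 * H / lam * (24 * α ^ 2 * ℓ ^ 4 * (12 * (ℓ / μ) ^ 2 * (5 * α ^ 2 / lam ^ 2))) ≤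
      35 / 100 * lam := by
    have e1 : 800 * X + 96 * X + 11520 * Y ^ 2 ≤ 35 / 100 := by linarith
    have e2 := mul_le_mul_of_nonneg_left e1 hl.le
    linarith
  -- The subinvariant vector is `(v₁, v₂, 1)`. Balance in the first two inequalities fixes the orders
  -- of `v₁` and `v₂`; the factors 5 and 12 (instead of the critical 4 and 6) give room for decay.
  -- The supersolution `(v₁ w, v₂ w / 2 + 2 α q / μ, w)` has the same shape, with `w` of the size of
  -- the noise in the tracking error, plus the noise of the optimality error in its second entry.
  set v₁ := 5 * α ^ 2 / lam ^ 2 with hv₁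
  have hv₁0 : 0 < v₁ := by positivity
  set v₂ := 12 * (ℓ / μ) ^ 2 * v₁ with hv₂
  have hv₂0 : 0 < v₂ := by positivity
  set w := 600 * (H * Q) / lam ^ 2 with hw
  have hw0 : 0 ≤ w := by positivity
  have hαv : 2 / lam * α ^ 2 = 2 / 5 * lam * v₁ := by
    rw [hv₁]; field_simp
  have hbv : 3 * α / μ * ℓ ^ 2 * v₁ = α * μ / 4 * v₂ := by
    rw [hv₂]; field_simp; norm_num
  have hmargin : α * μ / 4 ≤ lam / 10 := by linarith
  have hHl : 0 ≤ 8 * H / lam := by positivity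
  obtain ⟨M, hM⟩ := exists_le_geometric_add (a := a) (b := b) (c := c)
    (A₁ := 1 - lam / 2) (A₃ := 2 / lam * α ^ 2) (B₁ := 3 * α / μ * ℓ ^ 2) (B₂ := 1 - α * μ / 2)
    (C₁ := 8 * H / lam * (20 * ℓ ^ 2)) (C₂ := 8 * H / lam * (24 * α ^ 2 * ℓ ^ 4))
    (C₃ := 1 - lam / 2 + 8 * H / lam * (12 * ℓ ^ 2 * α ^ 2)) (r := α ^ 2 * q)
    (s := 8 * H / lam * (9 * Q)) (γ := 1 - α * μ / 4) (v₁ := v₁) (v₂ := v₂) (v₃ := 1)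
    (u₁ := v₁ * w) (u₂ := v₂ / 2 * w + 2 * (α * q / μ)) (u₃ := w)
    (by linarith) (by positivity) (by positivity) (by linarith) (by positivity) (by positivity)
    (add_nonneg (by linarith) (by positivity)) (by linarith) ha
    (fun k => (hb k).trans (by linarith)) (fun k => (hc k).trans (by linarith))
    hv₁0 hv₂0 one_pos
    (by
      have := mul_le_mul_of_nonneg_right hmargin hv₁0.le
      linarith)
    (by linarith) (by linarith) (by positivity) (by positivity) hw0
    (by
      have e1 : 2 / lam * α ^ 2 * w = 2 / 5 * lam * v₁ * w := by rw [hαv]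
      have e2 : 0 ≤ lam * v₁ * w := by positivity
      linarith)
    (by
      have e1 : 3 * α / μ * ℓ ^ 2 * v₁ * w = α * μ / 4 * v₂ * w := by rw [hbv]
      have e2 : α * μ / 2 * (2 * (α * q / μ)) = α ^ 2 * q := by field_simp
      linarith)
    (by
      have e1 : 24 * α ^ 2 * ℓ ^ 4 * (2 * (α * q / μ)) ≤ Q := by
        have f1 : 24 * α ^ 2 * ℓ ^ 4 * (2 * (α * q / μ)) =
            48 * (α * ℓ) * (Y * (lam ^ 4 / H)) * q := by
          rw [hY]; field_simp; ring
        have f2 : lam ^ 4 / H ≤ 1 := by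
          rw [div_le_one (by linarith)]
          exact (pow_le_one₀ hl.le hl1).trans hH
        have f3 : Y * (lam ^ 4 / H) ≤ 1 * 1 := by
          gcongr
          linarith
        have f4 : 48 * (α * ℓ) * (Y * (lam ^ 4 / H)) ≤ 1 * (1 * 1) := by
          gcongr
          linarith
        rw [f1]
        calc _ ≤ 1 * (1 * 1) * q := by gcongr
          _ ≤ Q := by linarith
      have e2 := mul_le_mul_of_nonneg_left e1 hHl
      have e3 := mul_le_mul_of_nonneg_right gain hw0
      have e4 : 8 * H / lam * (10 * Q) = 80 / 600 * (lam * w) := by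
        rw [hw]; field_simp; ring
      have e5 : 0 ≤ 8 * H / lam * (24 * α ^ 2 * ℓ ^ 4 * v₂) * w := by positivity
      have e6 : 0 ≤ lam * w := by positivity
      linarith)
  refine ⟨M * (v₁ + v₂), fun k => ?_⟩
  obtain ⟨h1, h2, -⟩ := hM k
  have h3 : v₁ * w ≤ (ℓ / μ) ^ 2 * (v₁ * w) :=
    le_mul_of_one_le_left (by positivity) (one_le_pow₀ ((one_le_div hμ).2 hμℓ))
  have h4 : 7 * ((ℓ / μ) ^ 2 * (v₁ * w)) =
      21000 * (α ^ 2 * (H * Q) * ℓ ^ 2 / (μ ^ 2 * lam ^ 4)) := by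
    rw [hv₁, hw]; field_simp; ring
  have h5 : v₂ / 2 * w = 6 * ((ℓ / μ) ^ 2 * (v₁ * w)) := by rw [hv₂]; ring
  linarith

end System

/-! ### Square integrability and conditional moments along the iteration -/

section SquareIntegrable

variable {n p : ℕ} {Ω : Type*} [MeasurableSpace Ω] {P : Measure Ω}

lemma integrable_inner_of_memLp {u w : Ω → EuclideanSpace ℝ (Fin p)} (hu : MemLp u 2 P)
    (hw : MemLp w 2 P) : Integrable (fun ω => inner ℝ (u ω) (w ω)) P := by
  refine (hu.norm.integrable_mul hw.norm).mono (hu.1.inner hw.1) (ae_of_all _ fun ω => ?_)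
  simpa using abs_real_inner_le_norm (u ω) (w ω)

lemma integrable_norm_sq_of_memLp {u : Ω → EuclideanSpace ℝ (Fin p)} (hu : MemLp u 2 P) :
    Integrable (fun ω => ‖u ω‖ ^ 2) P :=
  (memLp_two_iff_integrable_sq_norm hu.1).1 hu

variable {u : Ω → Fin n → EuclideanSpace ℝ (Fin p)}

lemma memLp_avg (hu : ∀ i, MemLp (fun ω => u ω i) 2 P) : MemLp (fun ω => avg (u ω)) 2 P :=
  (memLp_finsetSum Finset.univ fun i _ => hu i).const_smul (n : ℝ)⁻¹

lemma memLp_dev (y : Fin n → ℝ) (hu : ∀ i, MemLp (fun ω => u ω i) 2 P) (i : Fin n) :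
    MemLp (fun ω => dev y (u ω) i) 2 P :=
  (hu i).sub ((memLp_avg hu).const_smul (y i))

lemma integrable_scaledSq (B : Matrix (Fin n) (Fin n) ℝ) (v : Fin n → ℝ)
    (hu : ∀ i, MemLp (fun ω => u ω i) 2 P) : Integrable (fun ω => scaledSq B v (u ω)) P :=
  ((integrable_finsetSum Finset.univ fun i _ =>
    (integrable_norm_sq_of_memLp (hu i)).div_const (v i)).const_mul _).const_mul _

end SquareIntegrable

section Oracle

variable {n p : ℕ} {G : Digraph (Fin n)} {B : Matrix (Fin n) (Fin n) ℝ} {v : Fin n → ℝ}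
  {α μ ℓ σ : ℝ} {x₀ : Fin n → EuclideanSpace ℝ (Fin p)}
  {f : Fin n → EuclideanSpace ℝ (Fin p) → ℝ} {zs : EuclideanSpace ℝ (Fin p)}
  {Ω Ξ : Type*} [MeasurableSpace Ω] [MeasurableSpace Ξ] {P : Measure Ω} [IsProbabilityMeasure P]
  {ξ : ℕ → Fin n → Ω → Ξ}
  {g : Fin n → EuclideanSpace ℝ (Fin p) → Ξ → EuclideanSpace ℝ (Fin p)}

/-- The realization of the stochastic oracle at `ω`. -/
def realization (g : Fin n → EuclideanSpace ℝ (Fin p) → Ξ → EuclideanSpace ℝ (Fin p))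
    (ξ : ℕ → Fin n → Ω → Ξ) (ω : Ω) (k : ℕ) (i : Fin n) (z : EuclideanSpace ℝ (Fin p)) :
    EuclideanSpace ℝ (Fin p) :=
  g i z (ξ k i ω)

omit [MeasurableSpace Ω] in
lemma past_mono {k l : ℕ} (hkl : k ≤ l) : past ξ k ≤ past ξ l :=
  iSup_mono fun _ => iSup_mono' fun h => ⟨h.trans_le hkl, le_rfl⟩

lemma past_le (h : ∀ k i, Measurable (ξ k i)) (k : ℕ) : past ξ k ≤ ‹MeasurableSpace Ω› :=
  iSup_le fun l => iSup_le fun _ => iSup_le fun i => (h l i).comap_le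

omit [MeasurableSpace Ω] in
lemma measurable_past_seed (k : ℕ) (i : Fin n) : Measurable[past ξ (k + 1)] (ξ k i) := by
  rw [measurable_iff_comap_le]
  exact le_iSup_of_le k (le_iSup_of_le k.lt_succ_self (le_iSup_of_le i le_rfl))

omit [MeasurableSpace Ω] in
lemma measurable_sample (hg : ∀ i, Measurable (Function.uncurry (g i))) {k : ℕ} {i : Fin n}
    (hx : Measurable[past ξ k] fun ω => (iterate B α x₀ (realization g ξ ω) k).x i) :
    Measurable[past ξ (k + 1)] fun ω => sample B α x₀ (realization g ξ ω) k i := by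
  have hz : Measurable[past ξ (k + 1)] fun ω => (iterate B α x₀ (realization g ξ ω) k).z i := by
    simp_rw [iterate_z]
    exact (hx.mono (past_mono k.le_succ) le_rfl).const_smul (yVec B k i)⁻¹
  exact (hg i).comp (hz.prodMk (measurable_past_seed k i))

omit [MeasurableSpace Ω] in
lemma measurable_iterate (hg : ∀ i, Measurable (Function.uncurry (g i))) (k : ℕ) :
    (∀ i, Measurable[past ξ k] fun ω => (iterate B α x₀ (realization g ξ ω) k).x i) ∧
      ∀ i, Measurable[past ξ (k + 1)] fun ω => (iterate B α x₀ (realization g ξ ω) k).w i := by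
  induction k with
  | zero =>
    have h : ∀ i, Measurable[past ξ 0] fun ω => (iterate B α x₀ (realization g ξ ω) 0).x i :=
      fun i => measurable_const
    exact ⟨h, fun i => measurable_sample hg (h i)⟩
  | succ k ih =>
    obtain ⟨hx, hw⟩ := ih
    have hx' : ∀ i, Measurable[past ξ (k + 1)]
        fun ω => (iterate B α x₀ (realization g ξ ω) (k + 1)).x i := by
      intro i
      refine Measurable.sub (Finset.measurable_fun_sum _ fun j _ => ?_) ((hw i).const_smul α)
      exact ((hx j).mono (past_mono k.le_succ) le_rfl).const_smul (B i j)
    refine ⟨hx', fun i => ?_⟩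
    have hmono := past_mono (ξ := ξ) (k + 1).le_succ
    refine Measurable.sub (Measurable.add (Finset.measurable_fun_sum _ fun j _ => ?_) ?_) ?_
    · exact ((hw j).mono hmono le_rfl).const_smul (B i j)
    · exact measurable_sample hg (hx' i)
    · exact (measurable_sample hg (hx i)).mono hmono le_rfl

lemma continuous_gradient (hμ : 0 < μ) (hℓ : 0 < ℓ)
    (hf : ∀ i, IsStronglyConvexSmooth μ ℓ (f i)) (i : Fin n) : Continuous (gradient (f i)) := by
  refine (LipschitzWith.of_dist_le_mul (K := ⟨ℓ, hℓ.le⟩) fun x y => ?_).continuous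
  rw [dist_eq_norm, dist_eq_norm]
  exact (hf i).hasQuadraticBounds.norm_sub_le hμ.le hℓ x y

lemma memLp_gradient (hμ : 0 < μ) (hℓ : 0 < ℓ)
    (hf : ∀ i, IsStronglyConvexSmooth μ ℓ (f i)) (i : Fin n)
    {z : Ω → EuclideanSpace ℝ (Fin p)} (hz : MemLp z 2 P) :
    MemLp (fun ω => gradient (f i) (z ω)) 2 P := by
  have h0 : MemLp (fun ω => ‖gradient (f i) 0‖ + ℓ * ‖z ω‖) 2 P := by
    have h1 : MemLp (fun _ : Ω => ‖gradient (f i) 0‖) 2 P := memLp_const _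
    exact h1.add (hz.norm.const_mul ℓ)
  refine h0.of_le ((continuous_gradient hμ hℓ hf i).comp_aestronglyMeasurable hz.1) (ae_of_all _ fun ω => ?_)
  have h1 := (hf i).hasQuadraticBounds.norm_sub_le hμ.le hℓ (z ω) 0
  rw [sub_zero] at h1
  rw [Real.norm_of_nonneg (by positivity)]
  linarith [norm_le_norm_add_norm_sub' (gradient (f i) (z ω)) (gradient (f i) 0)]

variable (hμ : 0 < μ) (hℓ : 0 < ℓ) (hf : ∀ i, IsStronglyConvexSmooth μ ℓ (f i))
  (hO : IsSFO P f σ g ξ (zProc B α x₀ g ξ))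
include hO

omit [IsProbabilityMeasure P] in
lemma measurable_iterate_x (k : ℕ) (i : Fin n) :
    Measurable fun ω => (iterate B α x₀ (realization g ξ ω) k).x i :=
  ((measurable_iterate hO.measurable_grad k).1 i).mono (past_le hO.measurable_seed k) le_rfl

omit [IsProbabilityMeasure P] in
lemma measurable_sample_of_oracle (k : ℕ) (i : Fin n) :
    Measurable fun ω => sample B α x₀ (realization g ξ ω) k i :=
  (measurable_sample hO.measurable_grad ((measurable_iterate hO.measurable_grad k).1 i)).mono
    (past_le hO.measurable_seed (k + 1)) le_rfl

include hμ hℓ hf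

omit [IsProbabilityMeasure P] in
lemma memLp_sampleErr (k : ℕ) (i : Fin n) :
    MemLp (fun ω => sampleErr B α x₀ (realization g ξ ω) f k i) 2 P := by
  have hz : Measurable fun ω => (iterate B α x₀ (realization g ξ ω) k).z i := by
    simp_rw [iterate_z]
    exact (measurable_iterate_x hO k i).const_smul (yVec B k i)⁻¹
  have h : Measurable fun ω => sampleErr B α x₀ (realization g ξ ω) f k i :=
    (measurable_sample_of_oracle hO k i).sub
      ((continuous_gradient hμ hℓ hf i).measurable.comp hz)
  exact (memLp_two_iff_integrable_sq_norm h.aestronglyMeasurable).2 (hO.integrable_sq k i)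

lemma memLp_sample {k : ℕ} {i : Fin n}
    (hx : MemLp (fun ω => (iterate B α x₀ (realization g ξ ω) k).x i) 2 P) :
    MemLp (fun ω => (iterate B α x₀ (realization g ξ ω) k).z i) 2 P ∧
      MemLp (fun ω => gradient (f i) ((iterate B α x₀ (realization g ξ ω) k).z i)) 2 P ∧
      MemLp (fun ω => sample B α x₀ (realization g ξ ω) k i) 2 P := by
  have hz : MemLp (fun ω => (iterate B α x₀ (realization g ξ ω) k).z i) 2 P := by
    simp_rw [iterate_z]
    exact hx.const_smul (yVec B k i)⁻¹
  have hgrad := memLp_gradient hμ hℓ hf i hz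
  refine ⟨hz, hgrad, ?_⟩
  convert (memLp_sampleErr hμ hℓ hf hO k i).add hgrad using 1
  funext ω
  simp [sampleErr]

lemma memLp_iterate (k : ℕ) :
    (∀ i, MemLp (fun ω => (iterate B α x₀ (realization g ξ ω) k).x i) 2 P) ∧
      ∀ i, MemLp (fun ω => (iterate B α x₀ (realization g ξ ω) k).w i) 2 P := by
  induction k with
  | zero =>
    have h : ∀ i, MemLp (fun ω => (iterate B α x₀ (realization g ξ ω) 0).x i) 2 P :=
      fun i => memLp_const (x₀ i)
    exact ⟨h, fun i => (memLp_sample hμ hℓ hf hO (h i)).2.2⟩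
  | succ k ih =>
    obtain ⟨hx, hw⟩ := ih
    have hx' : ∀ i, MemLp (fun ω => (iterate B α x₀ (realization g ξ ω) (k + 1)).x i) 2 P :=
      fun i => (memLp_finsetSum Finset.univ fun j _ => (hx j).const_smul (B i j)).sub
        ((hw i).const_smul α)
    exact ⟨hx', fun i => ((memLp_finsetSum Finset.univ fun j _ => (hw j).const_smul (B i j)).add
      (memLp_sample hμ hℓ hf hO (hx' i)).2.2).sub (memLp_sample hμ hℓ hf hO (hx i)).2.2⟩

lemma integrable_consensusErr (v : Fin n → ℝ) (k : ℕ) :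
    Integrable (fun ω => consensusErr B v α x₀ (realization g ξ ω) k) P :=
  integrable_scaledSq B v (memLp_dev _ (memLp_iterate hμ hℓ hf hO k).1)

lemma integrable_trackingErr (v : Fin n → ℝ) (k : ℕ) :
    Integrable (fun ω => trackingErr B v α x₀ (realization g ξ ω) k) P :=
  integrable_scaledSq B v (memLp_dev _ (memLp_iterate hμ hℓ hf hO k).2)

lemma integrable_optErr (zs : EuclideanSpace ℝ (Fin p)) (k : ℕ) :
    Integrable (fun ω => optErr B α x₀ (realization g ξ ω) zs k) P :=
  (integrable_norm_sq_of_memLp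
    ((memLp_avg (memLp_iterate hμ hℓ hf hO k).1).sub (memLp_const zs))).const_mul _

omit [IsProbabilityMeasure P] in
lemma integrable_sum_norm_sampleErr_sq (k : ℕ) :
    Integrable (fun ω => ∑ i, ‖sampleErr B α x₀ (realization g ξ ω) f k i‖ ^ 2) P :=
  integrable_finsetSum _ fun i _ =>
    integrable_norm_sq_of_memLp (memLp_sampleErr hμ hℓ hf hO k i)

omit hμ hℓ hf in
lemma integral_norm_sampleErr_sq_le (k : ℕ) (i : Fin n) :
    ∫ ω, ‖sampleErr B α x₀ (realization g ξ ω) f k i‖ ^ 2 ∂P ≤ σ ^ 2 := by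
  have h1 := integral_condExp (μ := P) (past_le hO.measurable_seed k)
    (f := fun ω => ‖noise f g ξ (zProc B α x₀ g ξ) k i ω‖ ^ 2)
  have h2 := integral_mono_ae integrable_condExp (integrable_const (σ ^ 2)) (hO.variance_le k i)
  rw [h1] at h2
  have h3 : ∫ ω, ‖noise f g ξ (zProc B α x₀ g ξ) k i ω‖ ^ 2 ∂P ≤ σ ^ 2 := by simpa using h2
  exact h3

lemma integral_sum_norm_sampleErr_sq_le (k : ℕ) :
    ∫ ω, ∑ i, ‖sampleErr B α x₀ (realization g ξ ω) f k i‖ ^ 2 ∂P ≤ n * σ ^ 2 := by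
  rw [integral_finsetSum _ fun i _ =>
    integrable_norm_sq_of_memLp (memLp_sampleErr hμ hℓ hf hO k i)]
  refine (Finset.sum_le_sum fun i _ => integral_norm_sampleErr_sq_le hO k i).trans ?_
  simp

omit hμ hℓ hf in
lemma integral_inner_sampleErr_eq_zero (k : ℕ) {i j : Fin n} (hij : i ≠ j) :
    ∫ ω, inner ℝ (sampleErr B α x₀ (realization g ξ ω) f k i)
      (sampleErr B α x₀ (realization g ξ ω) f k j) ∂P = 0 := by
  have h1 := integral_condExp (μ := P) (past_le hO.measurable_seed k)
    (f := fun ω => inner ℝ (noise f g ξ (zProc B α x₀ g ξ) k i ω)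
      (noise f g ξ (zProc B α x₀ g ξ) k j ω))
  rw [integral_congr_ae (hO.uncorrelated k i j hij)] at h1
  have h2 : ∫ ω, inner ℝ (noise f g ξ (zProc B α x₀ g ξ) k i ω)
      (noise f g ξ (zProc B α x₀ g ξ) k j ω) ∂P = 0 := by simpa using h1.symm
  exact h2

/-- Averaging over the nodes divides the variance by `n`, as the sample errors of different nodes
are uncorrelated. -/
lemma integral_norm_avg_sampleErr_sq_le (hn : 0 < n) (k : ℕ) :
    ∫ ω, n * ‖avg (sampleErr B α x₀ (realization g ξ ω) f k)‖ ^ 2 ∂P ≤ σ ^ 2 := by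
  have hn' : (0 : ℝ) < n := by positivity
  have h1 : ∀ ω, n * ‖avg (sampleErr B α x₀ (realization g ξ ω) f k)‖ ^ 2 =
      (n : ℝ)⁻¹ * ∑ i, ∑ j, inner ℝ (sampleErr B α x₀ (realization g ξ ω) f k i)
        (sampleErr B α x₀ (realization g ξ ω) f k j) := by
    intro ω
    rw [avg, norm_smul, mul_pow, norm_inv, Real.norm_of_nonneg hn'.le,
      ← real_inner_self_eq_norm_sq, sum_inner]
    simp_rw [inner_sum]
    field_simp
  have hint : ∀ i j, Integrable (fun ω => inner ℝ (sampleErr B α x₀ (realization g ξ ω) f k i)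
      (sampleErr B α x₀ (realization g ξ ω) f k j)) P := fun i j =>
    integrable_inner_of_memLp (memLp_sampleErr hμ hℓ hf hO k i) (memLp_sampleErr hμ hℓ hf hO k j)
  simp_rw [h1]
  rw [integral_const_mul, integral_finsetSum _ fun i _ => integrable_finsetSum _ fun j _ =>
    hint i j]
  have h2 : ∀ i, ∫ ω, ∑ j, inner ℝ (sampleErr B α x₀ (realization g ξ ω) f k i)
      (sampleErr B α x₀ (realization g ξ ω) f k j) ∂P ≤ σ ^ 2 := by
    intro i
    rw [integral_finsetSum _ fun j _ => hint i j, Finset.sum_eq_single i]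
    · simp_rw [real_inner_self_eq_norm_sq]
      exact integral_norm_sampleErr_sq_le hO k i
    · exact fun j _ hj => integral_inner_sampleErr_eq_zero hO k hj.symm
    · simp
  calc (n : ℝ)⁻¹ * ∑ i, _ ≤ (n : ℝ)⁻¹ * ∑ _i : Fin n, σ ^ 2 := by
        gcongr with i
        exact h2 i
    _ = σ ^ 2 := by
        simp [hn'.ne']

/-- The sample errors are orthogonal to every square integrable variable of the past. -/
lemma integral_inner_past_sampleErr_eq_zero (k : ℕ) (i : Fin n)
    {U : Ω → EuclideanSpace ℝ (Fin p)} (hUm : Measurable[past ξ k] U) (hU : MemLp U 2 P) :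
    ∫ ω, inner ℝ (U ω) (sampleErr B α x₀ (realization g ξ ω) f k i) ∂P = 0 := by
  obtain ⟨-, hgrad, hs⟩ := memLp_sample hμ hℓ hf hO ((memLp_iterate hμ hℓ hf hO k).1 i)
  have h1 := integrable_inner_of_memLp hU hgrad
  have h2 := integrable_inner_of_memLp hU hs
  have h3 : P[fun ω => inner ℝ (U ω) (sample B α x₀ (realization g ξ ω) k i) | past ξ k] =ᵐ[P]
      fun ω => inner ℝ (U ω) (gradient (f i) ((iterate B α x₀ (realization g ξ ω) k).z i)) := by
    refine (condExp_bilin_of_stronglyMeasurable_left (innerSL ℝ) hUm.stronglyMeasurable h2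
      (hs.integrable one_le_two)).trans ?_
    filter_upwards [hO.unbiased k i] with ω hω
    exact congrArg (inner ℝ (U ω)) hω
  have h4 := integral_condExp (μ := P) (past_le hO.measurable_seed k)
    (f := fun ω => inner ℝ (U ω) (sample B α x₀ (realization g ξ ω) k i))
  rw [integral_congr_ae h3] at h4
  simp only [sampleErr, inner_sub_right]
  rw [integral_sub h2 h1, h4, sub_self]

/-- One step of the mean optimality error. -/
lemma integral_optErr_succ_le (hn : 0 < n) (hB : IsWeightMatrix G B) (hv : IsPerronVector B v)
    (hz : ∀ z, globalCost f zs ≤ globalCost f z) (hα : 0 < α) (hαμ : α * μ ≤ 1)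
    (hαℓ : α * ℓ ≤ 1) (k : ℕ) :
    ∫ ω, optErr B α x₀ (realization g ξ ω) zs (k + 1) ∂P ≤
      (1 - α * μ / 2) * ∫ ω, optErr B α x₀ (realization g ξ ω) zs k ∂P +
        3 * α / μ * (ℓ ^ 2 * ∫ ω, consensusErr B v α x₀ (realization g ξ ω) k ∂P) +
        α ^ 2 * σ ^ 2 := by
  set X : Ω → EuclideanSpace ℝ (Fin p) := fun ω => avg (iterate B α x₀ (realization g ξ ω) k).x
    with hX
  set D : Ω → EuclideanSpace ℝ (Fin p) := fun ω =>
    avg fun i => gradient (f i) ((iterate B α x₀ (realization g ξ ω) k).z i) with hD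
  set e : Ω → EuclideanSpace ℝ (Fin p) := fun ω => avg (sampleErr B α x₀ (realization g ξ ω) f k)
    with he
  set U : Ω → EuclideanSpace ℝ (Fin p) := fun ω => X ω - α • D ω - zs with hUdef
  have hxm := (measurable_iterate (B := B) (α := α) (x₀ := x₀) (ξ := ξ) hO.measurable_grad k).1
  have hXm : Measurable[past ξ k] X := by
    have h1 : Measurable[past ξ k] fun ω => ∑ i, (iterate B α x₀ (realization g ξ ω) k).x i :=
      Finset.measurable_fun_sum _ fun i _ => hxm i
    exact h1.const_smul (n : ℝ)⁻¹
  have hDm : Measurable[past ξ k] D := by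
    have h1 : Measurable[past ξ k] fun ω =>
        ∑ i, gradient (f i) ((iterate B α x₀ (realization g ξ ω) k).z i) := by
      refine Finset.measurable_fun_sum _ fun i _ => ?_
      refine (continuous_gradient hμ hℓ hf i).measurable.comp ?_
      simp_rw [iterate_z]
      exact (hxm i).const_smul (yVec B k i)⁻¹
    exact h1.const_smul (n : ℝ)⁻¹
  have hUm : Measurable[past ξ k] U := (hXm.sub (hDm.const_smul α)).sub measurable_const
  have hx := (memLp_iterate hμ hℓ hf hO k).1
  have hX2 : MemLp X 2 P := memLp_avg hx
  have hD2 : MemLp D 2 P := memLp_avg fun i => (memLp_sample hμ hℓ hf hO (hx i)).2.1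
  have he2 : MemLp e 2 P := memLp_avg (memLp_sampleErr hμ hℓ hf hO k)
  have hU2 : MemLp U 2 P := (hX2.sub (hD2.const_smul α)).sub (memLp_const zs)
  have horth : ∫ ω, inner ℝ (U ω) (e ω) ∂P = 0 := by
    simp only [he, avg, inner_smul_right, inner_sum]
    rw [integral_const_mul, integral_finsetSum _ fun i _ =>
      integrable_inner_of_memLp hU2 (memLp_sampleErr hμ hℓ hf hO k i)]
    rw [Finset.sum_eq_zero fun i _ => integral_inner_past_sampleErr_eq_zero hμ hℓ hf hO k i hUm hU2,
      mul_zero]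
  have hexp : ∀ ω, optErr B α x₀ (realization g ξ ω) zs (k + 1) =
      n * ‖U ω‖ ^ 2 + α ^ 2 * (n * ‖e ω‖ ^ 2) - 2 * α * n * inner ℝ (U ω) (e ω) := by
    intro ω
    have h1 : avg (iterate B α x₀ (realization g ξ ω) (k + 1)).x - zs = U ω - α • e ω := by
      rw [avg_iterate_x_succ hB, avg_sample (f := f), smul_add]
      simp only [hUdef, hX, hD, he]
      abel
    rw [optErr, h1, norm_sub_sq_real, inner_smul_right, norm_smul, mul_pow, Real.norm_eq_abs,
      sq_abs]
    ring
  have hstep : ∀ ω, n * ‖U ω‖ ^ 2 ≤ (1 - α * μ / 2) * optErr B α x₀ (realization g ξ ω) zs k +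
      3 * α / μ * (ℓ ^ 2 * consensusErr B v α x₀ (realization g ξ ω) k) := by
    intro ω
    have h1 := (hasQuadraticBounds_globalCost hn hf).inexact_step hμ hℓ hz hα hαμ hαℓ (X ω) (D ω)
    have h2 := card_mul_norm_avg_gradient_sub_sq_le (α := α) (x₀ := x₀) (S := realization g ξ ω)
      hn hB hv hμ hℓ hf k
    have h3 := mul_le_mul_of_nonneg_left h1 (Nat.cast_nonneg (α := ℝ) n)
    have h4 := mul_le_mul_of_nonneg_left h2 (by positivity : 0 ≤ 3 * α / μ)
    rw [optErr]
    refine h3.trans ?_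
    simp only [hX, hD] at h4 ⊢
    linarith
  have hiU := (integrable_norm_sq_of_memLp hU2).const_mul (n : ℝ)
  have hie := (integrable_norm_sq_of_memLp he2).const_mul (n : ℝ)
  have hiUe := integrable_inner_of_memLp hU2 he2
  have hia := integrable_consensusErr hμ hℓ hf hO v k
  have hib := integrable_optErr hμ hℓ hf hO zs k
  simp_rw [hexp]
  have hiUpe : Integrable (fun ω => n * ‖U ω‖ ^ 2 + α ^ 2 * (n * ‖e ω‖ ^ 2)) P :=
    hiU.add (hie.const_mul _)
  rw [integral_sub hiUpe (hiUe.const_mul _), integral_add hiU (hie.const_mul _),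
    integral_const_mul (2 * α * n), horth, integral_const_mul (α ^ 2)]
  have h1 := integral_mono hiU ((hib.const_mul _).add ((hia.const_mul _).const_mul _)) hstep
  simp only [Pi.add_apply] at h1
  rw [integral_add (hib.const_mul _) ((hia.const_mul _).const_mul _),
    integral_const_mul (1 - α * μ / 2), integral_const_mul (3 * α / μ),
    integral_const_mul (ℓ ^ 2)] at h1
  have h2 : α ^ 2 * ∫ ω, n * ‖e ω‖ ^ 2 ∂P ≤ α ^ 2 * σ ^ 2 := mul_le_mul_of_nonneg_left
    (integral_norm_avg_sampleErr_sq_le hμ hℓ hf hO hn k) (sq_nonneg α)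
  linarith

lemma integral_consensusErr_succ_le (hn : 0 < n) (hB : IsWeightMatrix G B)
    (hv : IsPerronVector B v) (hσ : sigmaB B v < 1) (k : ℕ) :
    ∫ ω, consensusErr B v α x₀ (realization g ξ ω) (k + 1) ∂P ≤
      (1 - (1 - sigmaB B v ^ 2) / 2) * ∫ ω, consensusErr B v α x₀ (realization g ξ ω) k ∂P +
        2 / (1 - sigmaB B v ^ 2) * α ^ 2 *
          ∫ ω, trackingErr B v α x₀ (realization g ξ ω) k ∂P := by
  have hia := integrable_consensusErr hμ hℓ hf hO v k
  have hic := integrable_trackingErr hμ hℓ hf hO v k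
  have h := integral_mono (integrable_consensusErr hμ hℓ hf hO v (k + 1))
    ((hia.const_mul _).add (hic.const_mul _))
    fun ω => consensusErr_succ_le hn hB hv hσ k
  simp only [Pi.add_apply] at h
  rwa [integral_add (hia.const_mul _) (hic.const_mul _), integral_const_mul,
    integral_const_mul] at h

/-- One step of the mean tracking error. -/
lemma integral_trackingErr_succ_le (hn : 0 < n) (hB : IsWeightMatrix G B)
    (hv : IsPerronVector B v) (hσ : sigmaB B v < 1)
    (hz : ∀ z, globalCost f zs ≤ globalCost f z) (hαℓ : 12 * (α ^ 2 * ℓ ^ 2) ≤ 1) (k : ℕ) :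
    ∫ ω, trackingErr B v α x₀ (realization g ξ ω) (k + 1) ∂P ≤
      (1 - (1 - sigmaB B v ^ 2) / 2) * ∫ ω, trackingErr B v α x₀ (realization g ξ ω) k ∂P +
        8 * (yInvSup B ^ 2 * ySup B ^ 2 * hRatio v) / (1 - sigmaB B v ^ 2) *
          (20 * ℓ ^ 2 * ∫ ω, consensusErr B v α x₀ (realization g ξ ω) k ∂P +
            12 * ℓ ^ 2 * α ^ 2 * ∫ ω, trackingErr B v α x₀ (realization g ξ ω) k ∂P +
            24 * α ^ 2 * ℓ ^ 4 * ∫ ω, optErr B α x₀ (realization g ξ ω) zs k ∂P +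
            9 * (n * σ ^ 2)) := by
  have hl := one_sub_sigmaB_sq_pos hσ
  have hh := one_le_hRatio hn hv
  have hia := integrable_consensusErr hμ hℓ hf hO v k
  have hib := integrable_optErr hμ hℓ hf hO zs k
  have hic := integrable_trackingErr hμ hℓ hf hO v k
  have hiN := integrable_sum_norm_sampleErr_sq hμ hℓ hf hO k
  have hiN' := integrable_sum_norm_sampleErr_sq hμ hℓ hf hO (k + 1)
  set H := yInvSup B ^ 2 * ySup B ^ 2 * hRatio v with hH
  have hHl : 0 ≤ 8 * H / (1 - sigmaB B v ^ 2) := by positivity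
  have hpt : ∀ ω, trackingErr B v α x₀ (realization g ξ ω) (k + 1) ≤
      (1 - (1 - sigmaB B v ^ 2) / 2) * trackingErr B v α x₀ (realization g ξ ω) k +
        8 * H / (1 - sigmaB B v ^ 2) *
          (20 * ℓ ^ 2 * consensusErr B v α x₀ (realization g ξ ω) k +
            12 * ℓ ^ 2 * α ^ 2 * trackingErr B v α x₀ (realization g ξ ω) k +
            24 * α ^ 2 * ℓ ^ 4 * optErr B α x₀ (realization g ξ ω) zs k +
            5 * ∑ i, ‖sampleErr B α x₀ (realization g ξ ω) f k i‖ ^ 2 +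
            4 * ∑ i, ‖sampleErr B α x₀ (realization g ξ ω) f (k + 1) i‖ ^ 2) := by
    intro ω
    refine (trackingErr_succ_le_of_costs hn hB hv hσ hμ hℓ hf hz k).trans ?_
    have h1 := consensusErr_nonneg (α := α) (x₀ := x₀) (S := realization g ξ ω) hn hv k
    have h2 : 0 ≤ ∑ i, ‖sampleErr B α x₀ (realization g ξ ω) f k i‖ ^ 2 := by positivity
    have h3 := mul_le_mul_of_nonneg_right hαℓ h2
    have h4 := mul_le_mul_of_nonneg_right hαℓ (mul_nonneg (sq_nonneg ℓ) h1)
    have h5 : 0 ≤ ℓ ^ 2 * consensusErr B v α x₀ (realization g ξ ω) k := by positivity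
    exact add_le_add le_rfl (mul_le_mul_of_nonneg_left (by linarith) hHl)
  have hi1 := hia.const_mul (20 * ℓ ^ 2)
  have hi2 := hic.const_mul (12 * ℓ ^ 2 * α ^ 2)
  have hi3 := hib.const_mul (24 * α ^ 2 * ℓ ^ 4)
  have hi4 := hiN.const_mul 5
  have hi5 := hiN'.const_mul 4
  have hs2 : Integrable (fun ω =>
      20 * ℓ ^ 2 * consensusErr B v α x₀ (realization g ξ ω) k +
      12 * ℓ ^ 2 * α ^ 2 * trackingErr B v α x₀ (realization g ξ ω) k) P := hi1.add hi2
  have hs3 : Integrable (fun ω =>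
      20 * ℓ ^ 2 * consensusErr B v α x₀ (realization g ξ ω) k +
      12 * ℓ ^ 2 * α ^ 2 * trackingErr B v α x₀ (realization g ξ ω) k +
      24 * α ^ 2 * ℓ ^ 4 * optErr B α x₀ (realization g ξ ω) zs k) P := hs2.add hi3
  have hs4 : Integrable (fun ω =>
      20 * ℓ ^ 2 * consensusErr B v α x₀ (realization g ξ ω) k +
      12 * ℓ ^ 2 * α ^ 2 * trackingErr B v α x₀ (realization g ξ ω) k +
      24 * α ^ 2 * ℓ ^ 4 * optErr B α x₀ (realization g ξ ω) zs k +
      5 * ∑ i, ‖sampleErr B α x₀ (realization g ξ ω) f k i‖ ^ 2) P := hs3.add hi4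
  have hs5 : Integrable (fun ω =>
      20 * ℓ ^ 2 * consensusErr B v α x₀ (realization g ξ ω) k +
      12 * ℓ ^ 2 * α ^ 2 * trackingErr B v α x₀ (realization g ξ ω) k +
      24 * α ^ 2 * ℓ ^ 4 * optErr B α x₀ (realization g ξ ω) zs k +
      5 * ∑ i, ‖sampleErr B α x₀ (realization g ξ ω) f k i‖ ^ 2 +
      4 * ∑ i, ‖sampleErr B α x₀ (realization g ξ ω) f (k + 1) i‖ ^ 2) P :=
    hs4.add hi5
  have h := integral_mono (integrable_trackingErr hμ hℓ hf hO v (k + 1))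
    ((hic.const_mul _).add (hs5.const_mul _)) hpt
  simp only [Pi.add_apply] at h
  rw [integral_add (hic.const_mul _) (hs5.const_mul _), integral_const_mul, integral_const_mul,
    integral_add hs4 hi5, integral_add hs3 hi4, integral_add hs2 hi3, integral_add hi1 hi2,
    integral_const_mul, integral_const_mul, integral_const_mul, integral_const_mul,
    integral_const_mul] at h
  have h1 := integral_sum_norm_sampleErr_sq_le hμ hℓ hf hO k
  have h2 := integral_sum_norm_sampleErr_sq_le hμ hℓ hf hO (k + 1)
  exact h.trans (add_le_add le_rfl (mul_le_mul_of_nonneg_left (by linarith) hHl))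

end Oracle

/-! ### Linear convergence to a ball -/

section Convergence

variable {n : ℕ} {G : Digraph (Fin n)} {B : Matrix (Fin n) (Fin n) ℝ} {v : Fin n → ℝ}
  {α μ ℓ σ : ℝ}

/-- The step-size condition, squared and cleared of denominators. -/
lemma step_condition (hn : 0 < n) (hB : IsWeightMatrix G B) (hv : IsPerronVector B v)
    (hμ : 0 < μ) (hℓ : 0 < ℓ) (hα : 0 < α)
    (hstep : α ≤ 1 / (ℓ * √(ℓ / μ)) * ((1 - sigmaB B v ^ 2) ^ 2 / (51 * √(tau B v)))) :
    2601 * (α ^ 2 * ℓ ^ 3 * (yInvSup B ^ 2 * ySup B ^ 2 * hRatio v)) ≤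
      μ * (1 - sigmaB B v ^ 2) ^ 4 := by
  have h1 := one_le_yInvSup hn hB hv
  have h2 := one_le_ySup hn hB hv
  have h3 := one_le_hRatio hn hv
  have hτ := le_tau hn hB hv
  have hτ0 : 0 < tau B v := lt_of_lt_of_le (by positivity) hτ
  have h4 := pow_le_pow_left₀ hα.le hstep 2
  rw [mul_pow, div_pow, div_pow, mul_pow, mul_pow, Real.sq_sqrt (by positivity),
    Real.sq_sqrt hτ0.le] at h4
  have h5 : (1 : ℝ) ^ 2 / (ℓ ^ 2 * (ℓ / μ)) *
      (((1 - sigmaB B v ^ 2) ^ 2) ^ 2 / (51 ^ 2 * tau B v)) =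
      μ * (1 - sigmaB B v ^ 2) ^ 4 / (2601 * (ℓ ^ 3 * tau B v)) := by
    field_simp
    norm_num
  rw [h5, le_div_iff₀ (by positivity)] at h4
  have h6 : α ^ 2 * (2601 * (ℓ ^ 3 * (yInvSup B ^ 2 * ySup B ^ 2 * hRatio v))) ≤
      α ^ 2 * (2601 * (ℓ ^ 3 * tau B v)) := by gcongr
  linarith

lemma step_mul_smooth_le (hn : 0 < n) (hG : IsStronglyConnected G) (hB : IsWeightMatrix G B)
    (hv : IsPerronVector B v) (hμ : 0 < μ) (hμℓ : μ ≤ ℓ) (hα : 0 < α)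
    (hstep : α ≤ 1 / (ℓ * √(ℓ / μ)) * ((1 - sigmaB B v ^ 2) ^ 2 / (51 * √(tau B v)))) :
    α * ℓ ≤ 1 / 51 := by
  have hl := one_sub_sigmaB_sq_pos (sigmaB_lt_one hn hG hB hv)
  have hl1 : 1 - sigmaB B v ^ 2 ≤ 1 := by linarith [sq_nonneg (sigmaB B v)]
  have h := mul_smooth_le_of_step hl hα hμ hμℓ (one_le_yInvSup_mul_ySup_mul_hRatio hn hB hv)
    (step_condition hn hB hv hμ (hμ.trans_le hμℓ) hα hstep)
  have := pow_le_one₀ (n := 2) hl.le hl1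
  linarith

lemma residual_nonneg {C : ℝ} (hC : 0 ≤ C) (hn : 0 < n) (hB : IsWeightMatrix G B)
    (hv : IsPerronVector B v) (hμ : 0 < μ) (hα : 0 < α) : 0 ≤ residual C B v μ ℓ σ α := by
  have h1 := one_le_yInvSup hn hB hv
  have h2 := one_le_ySup hn hB hv
  have h3 := one_le_hRatio hn hv
  have hτ0 : 0 ≤ tau B v := le_trans (by positivity) (le_tau hn hB hv)
  have h4 : 0 ≤ (1 - sigmaB B v ^ 2) ^ 4 := by positivity
  unfold residual
  positivity

lemma limsup_le_of_le_geometric {e : ℕ → ℝ} {M γ R : ℝ} (hγ0 : 0 ≤ γ) (hγ1 : γ < 1)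
    (he0 : ∀ k, 0 ≤ e k) (he : ∀ k, e k ≤ M * γ ^ k + R) : limsup e atTop ≤ R := by
  have h1 : Tendsto (fun k => M * γ ^ k + R) atTop (nhds R) := by
    simpa using ((tendsto_pow_atTop_nhds_zero_of_lt_one hγ0 hγ1).const_mul M).add_const R
  calc limsup e atTop ≤ limsup (fun k => M * γ ^ k + R) atTop :=
        limsup_le_limsup (Eventually.of_forall he)
          (isCoboundedUnder_le_of_le atTop he0) h1.isBoundedUnder_le
    _ = R := h1.limsup_eq

variable {p : ℕ} {x₀ : Fin n → EuclideanSpace ℝ (Fin p)}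
  {f : Fin n → EuclideanSpace ℝ (Fin p) → ℝ} {zs : EuclideanSpace ℝ (Fin p)}
  {Ω Ξ : Type*} [MeasurableSpace Ω] [MeasurableSpace Ξ] {P : Measure Ω} [IsProbabilityMeasure P]
  {ξ : ℕ → Fin n → Ω → Ξ}
  {g : Fin n → EuclideanSpace ℝ (Fin p) → Ξ → EuclideanSpace ℝ (Fin p)}

omit [MeasurableSpace Ω] in
lemma sqDist_nonneg (z : ℕ → Fin n → Ω → EuclideanSpace ℝ (Fin p)) (k : ℕ) (ω : Ω) :
    0 ≤ sqDist z zs k ω :=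
  Finset.sum_nonneg fun _ _ => sq_nonneg _

omit [IsProbabilityMeasure P] in
lemma meanError_nonneg (z : ℕ → Fin n → Ω → EuclideanSpace ℝ (Fin p)) (k : ℕ) :
    0 ≤ meanError P z zs k :=
  mul_nonneg (by positivity) (integral_nonneg fun ω => sqDist_nonneg z k ω)

lemma integrable_sqDist (hμ : 0 < μ) (hℓ : 0 < ℓ)
    (hf : ∀ i, IsStronglyConvexSmooth μ ℓ (f i))
    (hO : IsSFO P f σ g ξ (zProc B α x₀ g ξ)) (k : ℕ) :
    Integrable (sqDist (zProc B α x₀ g ξ) zs k) P :=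
  integrable_finsetSum _ fun i _ => integrable_norm_sq_of_memLp
    ((memLp_sample hμ hℓ hf hO ((memLp_iterate hμ hℓ hf hO k).1 i)).1.sub (memLp_const zs))

/-- Linear convergence of the mean error with rate `1 - α μ / 4`. -/
lemma meanError_le (hn : 0 < n) (hG : IsStronglyConnected G) (hB : IsWeightMatrix G B)
    (hv : IsPerronVector B v) (hμ : 0 < μ) (hμℓ : μ ≤ ℓ) (hα : 0 < α)
    (hstep : α ≤ 1 / (ℓ * √(ℓ / μ)) * ((1 - sigmaB B v ^ 2) ^ 2 / (51 * √(tau B v))))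
    (hf : ∀ i, IsStronglyConvexSmooth μ ℓ (f i))
    (hz : ∀ z, globalCost f zs ≤ globalCost f z)
    (hO : IsSFO P f σ g ξ (zProc B α x₀ g ξ)) :
    ∃ M : ℝ, ∀ k, meanError P (zProc B α x₀ g ξ) zs k ≤
      M * (1 - α * μ / 4) ^ k + residual 42000 B v μ ℓ σ α := by
  have hℓ : 0 < ℓ := hμ.trans_le hμℓ
  have hσ := sigmaB_lt_one hn hG hB hv
  have hl := one_sub_sigmaB_sq_pos hσ
  have hl1 : 1 - sigmaB B v ^ 2 ≤ 1 := by linarith [sq_nonneg (sigmaB B v)]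
  have hH := one_le_yInvSup_mul_ySup_mul_hRatio hn hB hv
  have hcond := step_condition hn hB hv hμ hℓ hα hstep
  have hαℓ := step_mul_smooth_le hn hG hB hv hμ hμℓ hα hstep
  have hαμ : α * μ ≤ 1 := by
    have : α * μ ≤ α * ℓ := by gcongr
    linarith
  have hαℓ12 : 12 * (α ^ 2 * ℓ ^ 2) ≤ 1 := by
    have h1 := pow_le_pow_left₀ (by positivity) hαℓ 2
    rw [mul_pow] at h1
    linarith
  have hn1 : (1 : ℝ) ≤ n := by exact_mod_cast hn
  have hn0 : (0 : ℝ) < n := by linarith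
  obtain ⟨M, hM⟩ := consensus_add_opt_le
    (a := fun k => ∫ ω, consensusErr B v α x₀ (realization g ξ ω) k ∂P)
    (b := fun k => ∫ ω, optErr B α x₀ (realization g ξ ω) zs k ∂P)
    (c := fun k => ∫ ω, trackingErr B v α x₀ (realization g ξ ω) k ∂P)
    (q := σ ^ 2) (Q := n * σ ^ 2) hl hl1 hα hμ hμℓ hH hcond (sq_nonneg σ)
    (le_mul_of_one_le_left (sq_nonneg σ) hn1)
    (integral_consensusErr_succ_le hμ hℓ hf hO hn hB hv hσ)
    (integral_optErr_succ_le hμ hℓ hf hO hn hB hv hz hα hαμ (by linarith))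
    (integral_trackingErr_succ_le hμ hℓ hf hO hn hB hv hσ hz hαℓ12)
  refine ⟨2 / n * M, fun k => ?_⟩
  have hia := integrable_consensusErr hμ hℓ hf hO v k
  have hib := integrable_optErr hμ hℓ hf hO zs k
  have h1 : ∫ ω, sqDist (zProc B α x₀ g ξ) zs k ω ∂P ≤
      2 * ∫ ω, consensusErr B v α x₀ (realization g ξ ω) k ∂P +
        2 * ∫ ω, optErr B α x₀ (realization g ξ ω) zs k ∂P := by
    have h2 := integral_mono (integrable_sqDist (zs := zs) hμ hℓ hf hO k)
      ((hia.const_mul 2).add (hib.const_mul 2))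
      fun ω => sum_norm_z_sub_sq_le hn hB hv zs k
    simp only [Pi.add_apply] at h2
    rwa [integral_add (hia.const_mul 2) (hib.const_mul 2), integral_const_mul,
      integral_const_mul] at h2
  have h2 := hM k
  set l := 1 - sigmaB B v ^ 2 with hldef
  set H := yInvSup B ^ 2 * ySup B ^ 2 * hRatio v with hHdef
  have hτ : H ≤ tau B v := le_tau hn hB hv
  calc meanError P (zProc B α x₀ g ξ) zs k
      ≤ 1 / n * (2 * (M * (1 - α * μ / 4) ^ k +
        (21000 * (α ^ 2 * (H * (n * σ ^ 2)) * ℓ ^ 2 / (μ ^ 2 * l ^ 4)) +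
          2 * (α * σ ^ 2 / μ)))) := by
        unfold meanError
        gcongr
        linarith
    _ = 2 / n * M * (1 - α * μ / 4) ^ k + (α * (4 * (σ ^ 2 / (n * μ))) +
        α ^ 2 * (42000 * H * (ℓ ^ 2 * σ ^ 2 / (μ ^ 2 * l ^ 4)))) := by
        field_simp
        ring
    _ ≤ 2 / n * M * (1 - α * μ / 4) ^ k + (α * (42000 * (σ ^ 2 / (n * μ))) +
        α ^ 2 * (42000 * tau B v * (ℓ ^ 2 * σ ^ 2 / (μ ^ 2 * l ^ 4)))) := by
        gcongr
        norm_num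
    _ = _ := rfl

/-- Strong convexity and smoothness force `μ ≤ ℓ` as soon as the space has two points. -/
lemma IsStronglyConvexSmooth.subsingleton_of_lt {f : EuclideanSpace ℝ (Fin p) → ℝ}
    (hf : IsStronglyConvexSmooth μ ℓ f) (h : ℓ < μ) :
    Subsingleton (EuclideanSpace ℝ (Fin p)) := by
  refine ⟨fun x y => ?_⟩
  have h1 := (hf.lower x y).trans (hf.upper x y)
  by_contra hxy
  have h2 : 0 < ‖x - y‖ := norm_pos_iff.2 (sub_ne_zero.2 hxy)
  have h3 : 0 < ‖x - y‖ ^ 2 := by positivity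
  nlinarith

end Convergence

end SAddOpt

theorem theorem1 :
    ∃ C : ℝ, 0 < C ∧
      ∀ (n : ℕ) (_ : 0 < n) (G : Digraph (Fin n)) (_ : SAddOpt.IsStronglyConnected G)
        (B : Matrix (Fin n) (Fin n) ℝ) (_ : SAddOpt.IsWeightMatrix G B)
        (v : Fin n → ℝ) (_ : SAddOpt.IsPerronVector B v)
        (μ ℓ α : ℝ) (_ : 0 < μ) (_ : 0 < ℓ) (_ : 0 < α)
        (_ : α ≤ 1 / (ℓ * √(ℓ / μ)) *
          ((1 - SAddOpt.sigmaB B v ^ 2) ^ 2 / (51 * √(SAddOpt.tau B v)))),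
        ∃ γ : ℝ, 0 ≤ γ ∧ γ < 1 ∧
          ∀ (p : ℕ) (f : Fin n → EuclideanSpace ℝ (Fin p) → ℝ)
            (_ : ∀ i, SAddOpt.IsStronglyConvexSmooth μ ℓ (f i))
            (zstar : EuclideanSpace ℝ (Fin p))
            (_ : ∀ z, SAddOpt.globalCost f zstar ≤ SAddOpt.globalCost f z)
            (σ : ℝ) (Ω : Type*) [MeasurableSpace Ω] (P : Measure Ω) [IsProbabilityMeasure P]
            (Ξ : Type*) [MeasurableSpace Ξ] (ξ : ℕ → Fin n → Ω → Ξ)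
            (g : Fin n → EuclideanSpace ℝ (Fin p) → Ξ → EuclideanSpace ℝ (Fin p))
            (x₀ : Fin n → EuclideanSpace ℝ (Fin p))
            (_ : SAddOpt.IsSFO P f σ g ξ (SAddOpt.zProc B α x₀ g ξ)),
            (∀ k, Integrable (SAddOpt.sqDist (SAddOpt.zProc B α x₀ g ξ) zstar k) P) ∧
            (∃ M : ℝ, ∀ k, SAddOpt.meanError P (SAddOpt.zProc B α x₀ g ξ) zstar k ≤
              M * γ ^ k + SAddOpt.residual C B v μ ℓ σ α) ∧
            limsup (fun k => SAddOpt.meanError P (SAddOpt.zProc B α x₀ g ξ) zstar k) atTop ≤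
              SAddOpt.residual C B v μ ℓ σ α := by
  refine ⟨42000, by norm_num, fun n hn G hG B hB v hv μ ℓ α hμ hℓ hα hstep => ?_⟩
  rcases le_or_gt μ ℓ with hμℓ | hμℓ
  · have hαℓ := SAddOpt.step_mul_smooth_le hn hG hB hv hμ hμℓ hα hstep
    have hαμ : α * μ ≤ α * ℓ := by gcongr
    have hαμ0 : 0 < α * μ := by positivity
    have hγ0 : 0 ≤ 1 - α * μ / 4 := by linarith
    have hγ1 : 1 - α * μ / 4 < 1 := by linarith
    refine ⟨1 - α * μ / 4, hγ0, hγ1, ?_⟩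
    intro p f hf zstar hz σ Ω _ P _ Ξ _ ξ g x₀ hO
    obtain ⟨M, hM⟩ := SAddOpt.meanError_le hn hG hB hv hμ hμℓ hα hstep hf hz hO
    exact ⟨SAddOpt.integrable_sqDist hμ hℓ hf hO, ⟨M, hM⟩,
      SAddOpt.limsup_le_of_le_geometric hγ0 hγ1 (SAddOpt.meanError_nonneg _) hM⟩
  · -- Here `p = 0`, so that all the points coincide and the error vanishes.
    refine ⟨0, le_rfl, one_pos, ?_⟩
    intro p f hf zstar hz σ Ω _ P _ Ξ _ ξ g x₀ hO
    have hsub := (hf ⟨0, hn⟩).subsingleton_of_lt hμℓ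
    have he : ∀ k, SAddOpt.meanError P (SAddOpt.zProc B α x₀ g ξ) zstar k = 0 := by
      intro k
      have h1 : ∀ i ω, SAddOpt.zProc B α x₀ g ξ k i ω = zstar := fun i ω => Subsingleton.elim _ _
      simp [SAddOpt.meanError, SAddOpt.sqDist, h1]
    have hR : 0 ≤ SAddOpt.residual 42000 B v μ ℓ σ α :=
      SAddOpt.residual_nonneg (by norm_num) hn hB hv hμ hα
    have hM : ∀ k, SAddOpt.meanError P (SAddOpt.zProc B α x₀ g ξ) zstar k ≤
        0 * 0 ^ k + SAddOpt.residual 42000 B v μ ℓ σ α := by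
      intro k
      rw [he, zero_mul, zero_add]
      exact hR
    exact ⟨SAddOpt.integrable_sqDist hμ hℓ hf hO, ⟨0, hM⟩,
      SAddOpt.limsup_le_of_le_geometric le_rfl one_pos (SAddOpt.meanError_nonneg _) hM⟩
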